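/- Let $\mathbb T$ be the unit circle with normalized Lebesgue measure $\ell$, let $I\subset\mathbb T$ be measurable with $\ell(I)>0$, put $J=\mathbb T\setminus I$, and assume $\ell(J)>0$. For $1\le p\le\infty$, let $H^p$ be the space of functions in $L^p(\mathbb T)$ (complex-valued) whose Fourier coefficients of strictly negative index vanish. For $1<s<\infty$, let $K_s$ be the norm of the conjugation operator $h\mapsto\widetilde h$ on the real space $L^s_{\mathbb R}(\mathbb T)$, where $\widetilde h$ is the function whose $n$-th Fourier coefficient is $-i\,\mathrm{sgn}(n)$ times that of $h$ (with $\mathrm{sgn}(0)=0$), i.e. $h+i\widetilde h$ is the boundary function of the Riesz--Herglotz transform of $h$. All norms on $I$ are taken with respect to $\ell$. Assume that the boundary of $I$ in $\mathbb T$ satisfies $\ell(\partial I)=0$ and that $f\in L^p(I)$ for some finite $p>2$. Let $g_0$ be the solution of the problem: $g_0\in H^2$, $|g_0|\le1$ a.e. on $J$, and $$\|f-g_0\|_{L^2(I)}=\min\{\|f-g\|_{L^2(I)} : g\in H^2,\ |g|\le 1\ \text{a.e. on } J\}.$$ Then $g_0\in H^p$, $K_{p/2}<\infty$, and $$\|g_0\|_{L^p(I)}\le(1+K_{p/2})\,\|f\|_{L^p(I)}.$$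 -/

import Mathlib

open MeasureTheory

open scoped ENNReal

noncomputable section

/-- The unit circle in the angular variable: a function `g` on it is `θ ↦ g (exp (i θ))`. -/
abbrev UCircle : Type := AddCircle (2 * Real.pi)

instance factTwoPiPos : Fact (0 < 2 * Real.pi) := ⟨Real.two_pi_pos⟩

/-- The normalized Lebesgue measure of the unit circle. -/
abbrev ell : Measure UCircle := AddCircle.haarAddCircle

/-- `g` represents an element of the Hardy space `H^p`: it lies in `L^p` of the circle and its
Fourier coefficients of strictly negative index vanish. -/
def MemHardy (p : ℝ≥0∞) (g : UCircle → ℂ) : Prop :=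
  MemLp g p ell ∧ ∀ n : ℤ, n < 0 → fourierCoeff g n = 0

/-- The candidates of the bounded extremal problem: `H²` functions of modulus at most `1`
almost everywhere on the complement of `I`. -/
def IsCandidate (I : Set UCircle) (g : UCircle → ℂ) : Prop :=
  MemHardy 2 g ∧ ∀ᵐ θ ∂(ell.restrict Iᶜ), ‖g θ‖ ≤ 1

/-- `g₀` solves the bounded extremal problem for the data `f` on `I`: it is a candidate which
minimizes the distance to `f` in `L²(I)` among all candidates. -/
def IsBEPSolution (I : Set UCircle) (f g₀ : UCircle → ℂ) : Prop :=
  IsCandidate I g₀ ∧ ∀ g : UCircle → ℂ, IsCandidate I g →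
    eLpNorm (f - g₀) 2 (ell.restrict I) ≤ eLpNorm (f - g) 2 (ell.restrict I)

/-- The integrable real function `k` is conjugate to the real function `h`: its Fourier series is
obtained from that of `h` through the multiplier `-i sgn n`. Equivalently, `h + i k` has no Fourier
coefficient of negative index and `k` has mean zero, so that `h + i k` is the boundary function
of the Riesz-Herglotz transform of `h`. -/
def IsConjugate (h k : UCircle → ℝ) : Prop :=
  Integrable k ell ∧ ∀ n : ℤ, fourierCoeff (fun θ => (k θ : ℂ)) n =
    -Complex.I * (n.sign : ℂ) * fourierCoeff (fun θ => (h θ : ℂ)) n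

/-- The operator norm of the conjugation operator on real `L^s` of the circle, as an extended
number (it is `∞` if the operator is not defined everywhere on `L^s` or is not bounded). -/
def conjugationNorm (s : ℝ≥0∞) : ℝ≥0∞ :=
  sInf {C : ℝ≥0∞ | ∀ h : UCircle → ℝ, MemLp h s ell →
    ∃ k : UCircle → ℝ, IsConjugate h k ∧ eLpNorm k s ell ≤ C * eLpNorm h s ell}

end

/-!
Let `u` be a function of Hardy type whose real part is bounded and vanishes off `I`. The variations
`g₀ * exp (t * u)` are again candidates, and the vanishing of the first derivative of the squared
distance at `t = 0` gives `∫ |g₀|² Re u = ∫ Re (φ u)` on `I`, where `φ = conj f * g₀`. As `Re u` is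
arbitrary and conjugation is skew-adjoint, this says that `|g₀|² = Re φ + k` on `I`, where `k` is
conjugate to `Im φ` extended by zero. Taking norms in `L^s` with `1 / s = 1 / p + 1 / q`,
`‖g₀‖_{2s}² ≤ (1 + K_s) ‖f‖_p ‖g₀‖_q`. Starting at `q = 2`, the exponent `q ↦ 2s` (a harmonic mean
of `p` and `q`) improves to `p` with bounds that stay uniform since `K_s` is bounded on compact
subintervals of `(1, ∞)`; for `q = p` the estimate is the claim.

For `1 < s ≤ 5 / 2` the bound of M. Riesz comes from an inequality `1 ≤ A cos^s t - B cos (s t)` on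
`|t| < π / 2` and the mean value property of `P ^ s`, where `Re P > 0`. It carries over from `s` to
`2s` because `(Im P)² - (Re P)²` is conjugate to `2 Re P Im P`, up to constants.
-/

noncomputable section

open ComplexConjugate Filter Polynomial Topology

/-! ### Polynomials on the circle -/

/-- The restriction of a polynomial to the unit circle: the coordinate `z` of the disk is
`fourier 1`. -/
def circlePoly : ℂ[X] →ₐ[ℂ] C(UCircle, ℂ) := aeval (fourier 1)

/-- The real part of a polynomial on the unit circle. -/
def rePoly : ℂ[X] →ₗ[ℝ] C(UCircle, ℝ) :=
  (Complex.reCLM.compLeftContinuous ℝ UCircle).toLinearMap ∘ₗ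
    circlePoly.toLinearMap.restrictScalars ℝ

/-- The imaginary part of a polynomial on the unit circle. -/
def imPoly : ℂ[X] →ₗ[ℝ] C(UCircle, ℝ) :=
  (Complex.imCLM.compLeftContinuous ℝ UCircle).toLinearMap ∘ₗ
    circlePoly.toLinearMap.restrictScalars ℝ

theorem circlePoly_apply (P : ℂ[X]) (θ : UCircle) : circlePoly P θ = P.eval (fourier 1 θ) := by
  rw [circlePoly, aeval_continuousMap_apply]

theorem rePoly_apply (P : ℂ[X]) (θ : UCircle) : rePoly P θ = (circlePoly P θ).re := rfl

theorem imPoly_apply (P : ℂ[X]) (θ : UCircle) : imPoly P θ = (circlePoly P θ).im := rfl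

theorem circlePoly_X_pow (m : ℕ) : circlePoly (X ^ m) = fourier (m : ℤ) := by
  induction m with
  | zero => ext θ; simp
  | succ m ih =>
    ext θ
    rw [pow_succ, map_mul, ih, ContinuousMap.mul_apply, Nat.cast_succ, fourier_add,
      circlePoly_apply, eval_X]

theorem norm_fourier_apply (n : ℤ) (θ : UCircle) : ‖(fourier n θ : ℂ)‖ = 1 := Circle.norm_coe _

theorem exists_fourier_one_eq {z : ℂ} (hz : ‖z‖ = 1) : ∃ θ : UCircle, (fourier 1 θ : ℂ) = z := by
  refine ⟨(z.arg : ℝ), ?_⟩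
  have hpolar := Complex.norm_mul_exp_arg_mul_I z
  rw [hz, Complex.ofReal_one, one_mul] at hpolar
  rw [fourier_coe_apply, ← hpolar]
  congr 1
  rw [hpolar]
  have hpi : (Real.pi : ℂ) ≠ 0 := by exact_mod_cast Real.pi_ne_zero
  push_cast
  field_simp

section

variable {E : Type*} [NormedAddCommGroup E] (φ : C(UCircle, E))

theorem memLp_of_continuousMap (s : ℝ≥0∞) : MemLp φ s ell :=
  φ.continuous.memLp_of_hasCompactSupport (HasCompactSupport.of_compactSpace _)

theorem integrable_of_continuousMap : Integrable φ ell :=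
  memLp_one_iff_integrable.1 (memLp_of_continuousMap φ 1)

theorem aestronglyMeasurable_of_continuousMap : AEStronglyMeasurable φ ell :=
  (integrable_of_continuousMap φ).1

end

theorem integral_ell_eq_circleAverage (F : ℂ → ℂ) :
    ∫ θ : UCircle, F (fourier 1 θ) ∂ell = Real.circleAverage F 0 1 := by
  have h := fourierCoeff_eq_intervalIntegral (T := 2 * Real.pi)
    (fun θ : UCircle => F (fourier 1 θ)) 0 0
  simp only [fourierCoeff, neg_zero, fourier_zero, one_smul] at h
  rw [h, Real.circleAverage, zero_add, one_div]
  congr 1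
  refine intervalIntegral.integral_congr fun x _ => ?_
  rw [fourier_coe_apply, circleMap]
  have hpi : (Real.pi : ℂ) ≠ 0 := by exact_mod_cast Real.pi_ne_zero
  simp only [Complex.ofReal_one, one_mul, zero_add]
  congr 2
  push_cast
  field_simp

theorem integral_ell_of_diffContOnCl {F : ℂ → ℂ} (hF : DiffContOnCl ℂ F (Metric.ball 0 1)) :
    ∫ θ : UCircle, F (fourier 1 θ) ∂ell = F 0 := by
  rw [integral_ell_eq_circleAverage]
  exact DiffContOnCl.circleAverage (by simpa using hF)

/-- The maximum principle for `exp (-P)`. -/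
theorem re_eval_pos_of_rePoly_pos {P : ℂ[X]} (hP : ∀ θ, 0 < rePoly P θ) {z : ℂ} (hz : ‖z‖ ≤ 1) :
    0 < (P.eval z).re := by
  obtain ⟨θ₀, hmin⟩ := (rePoly P).continuous.exists_forall_le_of_hasCompactSupport
    (HasCompactSupport.of_compactSpace _)
  refine (hP θ₀).trans_le ?_
  have hfrontier : ∀ w ∈ frontier (Metric.ball (0 : ℂ) 1),
      ‖Complex.exp (-P.eval w)‖ ≤ Real.exp (-rePoly P θ₀) := by
    intro w hw
    rw [frontier_ball _ one_ne_zero, mem_sphere_zero_iff_norm] at hw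
    obtain ⟨θ, rfl⟩ := exists_fourier_one_eq hw
    rw [Complex.norm_exp, Complex.neg_re, ← circlePoly_apply]
    exact Real.exp_le_exp.2 (neg_le_neg (hmin θ))
  have hbound := Complex.norm_le_of_forall_mem_frontier_norm_le Metric.isBounded_ball
    P.differentiable.neg.cexp.diffContOnCl hfrontier
    (by rwa [closure_ball _ one_ne_zero, mem_closedBall_zero_iff] : z ∈ _)
  simpa only [Complex.norm_exp, Pi.neg_apply, Complex.neg_re, Real.exp_le_exp, neg_le_neg_iff]
    using hbound

theorem integral_circlePoly_cpow {P : ℂ[X]} (hP : ∀ θ, 0 < rePoly P θ) (s : ℂ) :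
    ∫ θ, (circlePoly P θ) ^ s ∂ell = (P.eval 0) ^ s := by
  simp_rw [circlePoly_apply]
  refine integral_ell_of_diffContOnCl (F := fun z => (P.eval z) ^ s)
    (DifferentiableOn.diffContOnCl fun z hz => DifferentiableAt.differentiableWithinAt ?_)
  rw [closure_ball _ one_ne_zero, mem_closedBall_zero_iff] at hz
  exact P.differentiable.differentiableAt.cpow_const (Or.inl (re_eval_pos_of_rePoly_pos hP hz))

/-! ### The theorem of M. Riesz for polynomials -/

theorem cos_mul_le_cos_mul {a s t₀ t : ℝ} (ha : Real.pi / 2 ≤ a * t₀) (has : a ≤ s)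
    (hs : s ≤ 5 / 2) (ht₀ : 0 ≤ t₀) (ht₀t : t₀ ≤ t) (ht : t ≤ Real.pi / 2) :
    Real.cos (s * t) ≤ max (Real.cos (a * t₀)) (Real.cos (5 / 4 * Real.pi)) := by
  have ha0 : 0 ≤ a := by
    by_contra! h
    nlinarith [Real.pi_pos]
  have hlow : a * t₀ ≤ s * t := mul_le_mul has ht₀t ht₀ (ha0.trans has)
  have hupp : s * t ≤ 5 / 4 * Real.pi := by nlinarith [Real.pi_pos]
  rcases le_total (s * t) Real.pi with hst | hst
  · exact le_max_of_le_left <|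
      Real.cos_le_cos_of_nonneg_of_le_pi (by linarith [Real.pi_pos]) hst hlow
  · refine le_max_of_le_right ?_
    rw [← neg_le_neg_iff, ← Real.cos_sub_pi, ← Real.cos_sub_pi]
    exact Real.cos_le_cos_of_nonneg_of_le_pi (by linarith) (by linarith [Real.pi_pos])
      (by linarith)

/-- Near `|t| = π / 2` the term `-cos (s * t)` is bounded below because `s > 1`; elsewhere
`cos t ^ s` is. -/
theorem exists_one_le_mul_cos_rpow_sub_mul_cos {a : ℝ} (ha : 1 < a) :
    ∃ A B : ℝ, 1 ≤ A ∧ 0 ≤ B ∧ ∀ s ∈ Set.Icc a (5 / 2), ∀ t : ℝ, |t| < Real.pi / 2 →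
      1 ≤ A * Real.cos t ^ s - B * Real.cos (s * t) := by
  have hpi := Real.pi_pos
  wlog ha' : a ≤ 5 / 4 generalizing a
  · obtain ⟨A, B, hA, hB, h⟩ := this (a := 5 / 4) (by norm_num) le_rfl
    exact ⟨A, B, hA, hB, fun s hs => h s ⟨(not_le.1 ha').le.trans hs.1, hs.2⟩⟩
  set t₀ : ℝ := Real.pi / 2 * ((1 + a) / (2 * a)) with ht₀
  have hat₀ : a * t₀ = Real.pi / 4 * (1 + a) := by rw [ht₀]; field_simp; ring
  have ht₀_pos : 0 < t₀ := by positivity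
  have ht₀_lt : t₀ < Real.pi / 2 := by nlinarith
  set c : ℝ := max (Real.cos (a * t₀)) (Real.cos (5 / 4 * Real.pi))
  have hc_neg : c < 0 := max_lt
    (Real.cos_neg_of_pi_div_two_lt_of_lt (by nlinarith) (by nlinarith))
    (Real.cos_neg_of_pi_div_two_lt_of_lt (by linarith) (by linarith))
  have hcos_pos : 0 < Real.cos t₀ := Real.cos_pos_of_mem_Ioo ⟨by linarith, ht₀_lt⟩
  set B : ℝ := (-c)⁻¹ with hB
  have hB_pos : 0 < B := inv_pos.2 (neg_pos.2 hc_neg)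
  refine ⟨(1 + B) / Real.cos t₀ ^ 3, B, ?_, hB_pos.le, fun s hs t ht => ?_⟩
  · rw [le_div_iff₀ (by positivity)]
    linarith [pow_le_one₀ hcos_pos.le (Real.cos_le_one t₀) (n := 3)]
  rw [← Real.cos_abs t, ← Real.cos_abs (s * t), abs_mul, abs_of_pos (show 0 < s by linarith [hs.1])]
  have hcos_t : 0 < Real.cos |t| := Real.cos_pos_of_mem_Ioo ⟨by linarith [abs_nonneg t], ht⟩
  rcases le_total t₀ |t| with htt | htt
  · have hle : Real.cos (s * |t|) ≤ c :=
      cos_mul_le_cos_mul (by nlinarith) hs.1 hs.2 ht₀_pos.le htt ht.le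
    have hBc : B * c = -1 := by rw [hB, inv_neg, neg_mul, inv_mul_cancel₀ hc_neg.ne]
    have hpos : 0 ≤ (1 + B) / Real.cos t₀ ^ 3 * Real.cos |t| ^ s := by positivity
    nlinarith
  · have hpow : Real.cos t₀ ^ 3 ≤ Real.cos |t| ^ s :=
      calc Real.cos t₀ ^ 3 ≤ Real.cos |t| ^ 3 := pow_le_pow_left₀ hcos_pos.le
            (Real.cos_le_cos_of_nonneg_of_le_pi (abs_nonneg t) (by linarith) htt) 3
        _ = Real.cos |t| ^ (3 : ℝ) := by norm_cast
        _ ≤ Real.cos |t| ^ s :=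
          Real.rpow_le_rpow_of_exponent_ge hcos_t (Real.cos_le_one _) (by linarith [hs.2])
    have hle : 1 + B ≤ (1 + B) / Real.cos t₀ ^ 3 * Real.cos |t| ^ s := by
      rw [div_mul_eq_mul_div, le_div_iff₀ (by positivity)]
      gcongr
    nlinarith [Real.cos_le_one (s * |t|)]

theorem exists_abs_im_rpow_le {a : ℝ} (ha : 1 < a) :
    ∃ A B : ℝ, 1 ≤ A ∧ 0 ≤ B ∧ ∀ s ∈ Set.Icc a (5 / 2), ∀ z : ℂ, 0 < z.re →
      |z.im| ^ s ≤ A * z.re ^ s - B * (z ^ (s : ℂ)).re := by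
  obtain ⟨A, B, hA, hB, h⟩ := exists_one_le_mul_cos_rpow_sub_mul_cos ha
  refine ⟨A, B, hA, hB, fun s hs z hz => ?_⟩
  have harg : |z.arg| < Real.pi / 2 := Complex.abs_arg_lt_pi_div_two_iff.2 (Or.inl hz)
  have hcos : 0 < Real.cos z.arg := Real.cos_pos_of_mem_Ioo (abs_lt.1 harg)
  have hnorm : 0 ≤ ‖z‖ ^ s := by positivity
  calc |z.im| ^ s ≤ ‖z‖ ^ s :=
        Real.rpow_le_rpow (abs_nonneg _) (Complex.abs_im_le_norm z) (by linarith [hs.1])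
    _ ≤ ‖z‖ ^ s * (A * Real.cos z.arg ^ s - B * Real.cos (s * z.arg)) :=
        le_mul_of_one_le_right hnorm (h s hs z.arg harg)
    _ = A * z.re ^ s - B * (z ^ (s : ℂ)).re := by
        rw [Complex.cpow_ofReal_re, ← Complex.norm_mul_cos_arg z,
          Real.mul_rpow (norm_nonneg _) hcos.le, mul_comm z.arg]
        ring

theorem eLpNorm_le_of_integral_rpow_le {φ ψ : UCircle → ℝ} {s : ℝ} (hs : 1 ≤ s)
    (hφ : MemLp φ (ENNReal.ofReal s) ell) (hψ : MemLp ψ (ENNReal.ofReal s) ell) {A : NNReal}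
    (hA : 1 ≤ A) (h : ∫ θ, |φ θ| ^ s ∂ell ≤ A * ∫ θ, |ψ θ| ^ s ∂ell) :
    eLpNorm φ (ENNReal.ofReal s) ell ≤ A * eLpNorm ψ (ENNReal.ofReal s) ell := by
  have hs_pos : 0 < s := by linarith
  have hs_ne : ENNReal.ofReal s ≠ 0 := by simpa using hs_pos
  rw [hφ.eLpNorm_eq_integral_rpow_norm hs_ne ENNReal.ofReal_ne_top,
    hψ.eLpNorm_eq_integral_rpow_norm hs_ne ENNReal.ofReal_ne_top,
    ENNReal.toReal_ofReal hs_pos.le, ← ENNReal.ofReal_coe_nnreal (p := A),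
    ← ENNReal.ofReal_mul A.coe_nonneg]
  refine ENNReal.ofReal_le_ofReal ?_
  have hψ_int : 0 ≤ ∫ θ, |ψ θ| ^ s ∂ell := integral_nonneg fun θ => by positivity
  calc (∫ θ, |φ θ| ^ s ∂ell) ^ s⁻¹ ≤ (A * ∫ θ, |ψ θ| ^ s ∂ell) ^ s⁻¹ := by gcongr
    _ = (A : ℝ) ^ s⁻¹ * (∫ θ, |ψ θ| ^ s ∂ell) ^ s⁻¹ := Real.mul_rpow A.2 hψ_int
    _ ≤ A * (∫ θ, |ψ θ| ^ s ∂ell) ^ s⁻¹ := by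
        gcongr
        exact Real.rpow_le_self_of_one_le (mod_cast hA) (inv_le_one_of_one_le₀ hs)

theorem integral_re_circlePoly_cpow_nonneg {P : ℂ[X]} (hP : (P.eval 0).im = 0)
    (hpos : ∀ θ, 0 < rePoly P θ) (s : ℝ) :
    0 ≤ ∫ θ, ((circlePoly P θ) ^ (s : ℂ)).re ∂ell := by
  have hint : Integrable (fun θ => (circlePoly P θ) ^ (s : ℂ)) ell :=
    integrable_of_continuousMap ⟨fun θ => (circlePoly P θ) ^ (s : ℂ),
      (circlePoly P).continuous.cpow continuous_const fun θ => Or.inl (hpos θ)⟩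
  have h0 : 0 < (P.eval 0).re := re_eval_pos_of_rePoly_pos hpos (by simp)
  have heval : P.eval 0 = ((P.eval 0).re : ℂ) := Complex.ext rfl hP
  calc (0 : ℝ) ≤ (P.eval 0).re ^ s := by positivity
    _ = (∫ θ, (circlePoly P θ) ^ (s : ℂ) ∂ell).re := by
        rw [integral_circlePoly_cpow hpos, heval, ← Complex.ofReal_cpow h0.le,
          Complex.ofReal_re, Complex.ofReal_re]
    _ = ∫ θ, ((circlePoly P θ) ^ (s : ℂ)).re ∂ell := (integral_re (𝕜 := ℂ) hint).symm

theorem exists_eLpNorm_imPoly_le_of_rePoly_pos {a : ℝ} (ha : 1 < a) :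
    ∃ A : NNReal, ∀ s ∈ Set.Icc a (5 / 2), ∀ P : ℂ[X], (P.eval 0).im = 0 →
      (∀ θ, 0 < rePoly P θ) → eLpNorm (imPoly P) (ENNReal.ofReal s) ell ≤
        A * eLpNorm (rePoly P) (ENNReal.ofReal s) ell := by
  obtain ⟨A, B, hA, hB, h⟩ := exists_abs_im_rpow_le ha
  refine ⟨⟨A, by linarith⟩, fun s hs P hP hpos => ?_⟩
  have hs_nonneg : 0 ≤ s := by linarith [hs.1]
  refine eLpNorm_le_of_integral_rpow_le (by linarith [hs.1]) (memLp_of_continuousMap _ _)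
    (memLp_of_continuousMap _ _) (mod_cast hA) ?_
  have him : Integrable (fun θ => |imPoly P θ| ^ s) ell :=
    integrable_of_continuousMap ⟨fun θ => |imPoly P θ| ^ s, by fun_prop (disch := assumption)⟩
  have hre : Integrable (fun θ => |rePoly P θ| ^ s) ell :=
    integrable_of_continuousMap ⟨fun θ => |rePoly P θ| ^ s, by fun_prop (disch := assumption)⟩
  have hpow : Integrable (fun θ => ((circlePoly P θ) ^ (s : ℂ)).re) ell :=
    integrable_of_continuousMap ⟨fun θ => ((circlePoly P θ) ^ (s : ℂ)).re,
      Complex.continuous_re.comp <|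
        (circlePoly P).continuous.cpow continuous_const fun θ => Or.inl (hpos θ)⟩
  have hmean := integral_re_circlePoly_cpow_nonneg hP hpos s
  calc ∫ θ, |imPoly P θ| ^ s ∂ell
      ≤ ∫ θ, (A * |rePoly P θ| ^ s - B * ((circlePoly P θ) ^ (s : ℂ)).re) ∂ell := by
        refine integral_mono him ((hre.const_mul A).sub (hpow.const_mul B)) fun θ => ?_
        simp only [abs_of_pos (hpos θ)]
        exact h s hs (circlePoly P θ) (hpos θ)
    _ = A * ∫ θ, |rePoly P θ| ^ s ∂ell - B * ∫ θ, ((circlePoly P θ) ^ (s : ℂ)).re ∂ell := by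
        rw [integral_sub (hre.const_mul A) (hpow.const_mul B), integral_const_mul,
          integral_const_mul]
    _ ≤ A * ∫ θ, |rePoly P θ| ^ s ∂ell := by nlinarith

/-- Each trigonometric polynomial is the sum of a polynomial and of the conjugate of another, hence
its real part is the real part of a polynomial. -/
theorem exists_rePoly_eq_re_of_mem_span {τ : C(UCircle, ℂ)}
    (hτ : τ ∈ Submodule.span ℂ (Set.range (@fourier (2 * Real.pi)))) :
    ∃ P : ℂ[X], (P.eval 0).im = 0 ∧ ∀ θ, rePoly P θ = (τ θ).re := by
  suffices hsum : ∃ P Q : ℂ[X], ∀ θ, τ θ = circlePoly P θ + conj (circlePoly Q θ) by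
    obtain ⟨P, Q, h⟩ := hsum
    refine ⟨P + Q - C (((P + Q).eval 0).im * Complex.I), by simp, fun θ => ?_⟩
    simp [rePoly_apply, circlePoly_apply, h θ]
  induction hτ using Submodule.span_induction with
  | mem x hx =>
    obtain ⟨n, rfl⟩ := hx
    obtain ⟨m, rfl | rfl⟩ := n.eq_nat_or_neg
    · exact ⟨X ^ m, 0, fun θ => by simp [circlePoly_X_pow]⟩
    · exact ⟨0, X ^ m, fun θ => by rw [circlePoly_X_pow, fourier_neg]; simp⟩
  | zero => exact ⟨0, 0, fun θ => by simp⟩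
  | add x y _ _ hx hy =>
    obtain ⟨P, Q, h⟩ := hx
    obtain ⟨P', Q', h'⟩ := hy
    refine ⟨P + P', Q + Q', fun θ => ?_⟩
    simp only [ContinuousMap.add_apply, h, h', map_add]
    ring
  | smul a x _ hx =>
    obtain ⟨P, Q, h⟩ := hx
    refine ⟨a • P, conj a • Q, fun θ => ?_⟩
    simp only [ContinuousMap.smul_apply, h, map_smul, smul_eq_mul, map_mul, Complex.conj_conj]
    ring

theorem exists_rePoly_near (φ : C(UCircle, ℝ)) {ε : ℝ} (hε : 0 < ε) :
    ∃ P : ℂ[X], (P.eval 0).im = 0 ∧ ∀ θ, |rePoly P θ - φ θ| < ε := by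
  set Φ : C(UCircle, ℂ) := ⟨fun θ => (φ θ : ℂ), by fun_prop⟩ with hΦ
  have hmem : Φ ∈ closure (Submodule.span ℂ (Set.range (@fourier (2 * Real.pi))) : Set _) := by
    rw [← Submodule.topologicalClosure_coe, span_fourier_closure_eq_top]
    trivial
  obtain ⟨τ, hτ, hdist⟩ := Metric.mem_closure_iff.1 hmem ε hε
  obtain ⟨P, hP0, hP⟩ := exists_rePoly_eq_re_of_mem_span hτ
  refine ⟨P, hP0, fun θ => ?_⟩
  calc |rePoly P θ - φ θ| = |(τ θ - Φ θ).re| := by simp [hP, hΦ]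
    _ ≤ ‖τ θ - Φ θ‖ := Complex.abs_re_le_norm _
    _ = dist (Φ θ) (τ θ) := by rw [dist_comm, dist_eq_norm]
    _ < ε := (ContinuousMap.dist_apply_le_dist θ).trans_lt hdist

/-- The theorem of M. Riesz in `L^s` with constant `C`, for polynomials. -/
def RieszBound (s : ℝ≥0∞) (C : NNReal) : Prop :=
  ∀ P : ℂ[X], (P.eval 0).im = 0 → eLpNorm (imPoly P) s ell ≤ C * eLpNorm (rePoly P) s ell

theorem RieszBound.mono {s : ℝ≥0∞} {C C' : NNReal} (h : RieszBound s C) (hC : C ≤ C') :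
    RieszBound s C' :=
  fun P hP => (h P hP).trans (by gcongr)

theorem exists_sub_eq_of_rePoly_pos (R : ℂ[X]) (hR : (R.eval 0).im = 0) {ε : ℝ} (hε : 0 < ε) :
    ∃ P Q : ℂ[X], P - Q = R ∧
      ((P.eval 0).im = 0 ∧ ∀ θ, 0 < rePoly P θ ∧ rePoly P θ ≤ |rePoly R θ| + ε) ∧
      ((Q.eval 0).im = 0 ∧ ∀ θ, 0 < rePoly Q θ ∧ rePoly Q θ ≤ |rePoly R θ| + ε) := by
  obtain ⟨P, hP0, hP⟩ := exists_rePoly_near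
    ⟨fun θ => max (rePoly R θ) 0 + ε / 2, by fun_prop⟩ (half_pos hε)
  simp only [ContinuousMap.coe_mk, abs_lt] at hP
  refine ⟨P, P - R, sub_sub_cancel _ _, ⟨hP0, fun θ => ?_⟩, by simp [hP0, hR], fun θ => ?_⟩
  · have hmax : max (rePoly R θ) 0 ≤ |rePoly R θ| := max_le (le_abs_self _) (abs_nonneg _)
    constructor <;> linarith [hP θ, le_max_right (rePoly R θ) 0]
  · have hmax : max (rePoly R θ) 0 - rePoly R θ ≤ |rePoly R θ| := by
      rw [← max_sub_sub_right, sub_self, zero_sub]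
      exact max_le (abs_nonneg _) (neg_le_abs _)
    rw [map_sub, ContinuousMap.sub_apply]
    constructor <;> linarith [hP θ, le_max_left (rePoly R θ) 0]

theorem eLpNorm_le_add_of_abs_le {φ ψ : C(UCircle, ℝ)} {ε : NNReal}
    (h : ∀ θ, |φ θ| ≤ |ψ θ| + ε) {s : ℝ≥0∞} (hs : 1 ≤ s) :
    eLpNorm φ s ell ≤ eLpNorm ψ s ell + ε :=
  calc eLpNorm φ s ell ≤ eLpNorm ((fun θ => ‖ψ θ‖) + fun _ => (ε : ℝ)) s ell :=
        eLpNorm_mono_real h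
    _ ≤ eLpNorm (fun θ => ‖ψ θ‖) s ell + eLpNorm (fun _ : UCircle => (ε : ℝ)) s ell :=
        eLpNorm_add_le (aestronglyMeasurable_of_continuousMap ψ).norm aestronglyMeasurable_const hs
    _ = eLpNorm ψ s ell + ε := by
        rw [eLpNorm_norm, eLpNorm_const _ (by positivity) (NeZero.ne ell)]
        simp

theorem exists_rieszBound_Icc_five_halves {a : ℝ} (ha : 1 < a) :
    ∃ C : NNReal, ∀ s ∈ Set.Icc a (5 / 2), RieszBound (ENNReal.ofReal s) C := by
  obtain ⟨A, hA⟩ := exists_eLpNorm_imPoly_le_of_rePoly_pos ha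
  refine ⟨2 * A, fun s hs R hR => ?_⟩
  set S := ENNReal.ofReal s
  set N := eLpNorm (rePoly R) S ell
  have hS : 1 ≤ S := ENNReal.one_le_ofReal.2 (by linarith [hs.1])
  have happrox (ε : NNReal) (hε : 0 < ε) : eLpNorm (imPoly R) S ell ≤ ↑(2 * A) * (N + ε) := by
    obtain ⟨P, Q, rfl, ⟨hP0, hP⟩, hQ0, hQ⟩ := exists_sub_eq_of_rePoly_pos R hR (ε := ε) hε
    have hbound (T : ℂ[X]) (hT0 : (T.eval 0).im = 0)
        (hT : ∀ θ, 0 < rePoly T θ ∧ rePoly T θ ≤ |rePoly (P - Q) θ| + ε) :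
        eLpNorm (imPoly T) S ell ≤ A * (N + ε) :=
      (hA s hs T hT0 fun θ => (hT θ).1).trans <| mul_le_mul_right
        (eLpNorm_le_add_of_abs_le (fun θ => by rw [abs_of_pos (hT θ).1]; exact (hT θ).2) hS) _
    calc eLpNorm (imPoly (P - Q)) S ell
        ≤ eLpNorm (imPoly P) S ell + eLpNorm (imPoly Q) S ell := by
          rw [map_sub, ContinuousMap.coe_sub]
          exact eLpNorm_sub_le (aestronglyMeasurable_of_continuousMap _)
            (aestronglyMeasurable_of_continuousMap _) hS
      _ ≤ A * (N + ε) + A * (N + ε) := add_le_add (hbound P hP0 hP) (hbound Q hQ0 hQ)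
      _ = ↑(2 * A) * (N + ε) := by push_cast; ring
  have hlim : Tendsto (fun ε : NNReal => ↑(2 * A) * (N + ε)) (𝓝[>] 0)
      (𝓝 (↑(2 * A) * (N + (0 : NNReal)))) := by
    refine ENNReal.Tendsto.const_mul ?_ (Or.inr ENNReal.coe_ne_top)
    exact tendsto_const_nhds.add ((ENNReal.continuous_coe.tendsto 0).mono_left inf_le_left)
  simpa using ge_of_tendsto hlim (eventually_mem_nhdsWithin.mono happrox)

section

variable {α E : Type*} [MeasurableSpace α] {μ : Measure α}

theorem eLpNorm_norm_sq_eq [NormedAddCommGroup E] (φ : α → E) (s : ℝ≥0∞) :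
    eLpNorm (fun x => ‖φ x‖ ^ 2) s μ = eLpNorm φ (2 * s) μ ^ 2 := by
  simpa [mul_comm] using eLpNorm_norm_rpow (p := s) (μ := μ) φ two_pos

theorem eLpNorm_mul_le_mul_eLpNorm [NormedRing E] {φ ψ : α → E} {p q s : ℝ≥0∞}
    (hφ : AEStronglyMeasurable φ μ) (hψ : AEStronglyMeasurable ψ μ) [ENNReal.HolderTriple p q s] :
    eLpNorm (φ * ψ) s μ ≤ eLpNorm φ p μ * eLpNorm ψ q μ := by
  simpa only [smul_eq_mul] using eLpNorm_smul_le_mul_eLpNorm hψ hφ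

end

theorem holderTriple_two_mul (s : ℝ≥0∞) : ENNReal.HolderTriple (2 * s) (2 * s) s where
  inv_add_inv_eq_inv := by
    rw [ENNReal.mul_inv (by simp) (by simp), ← add_mul, ENNReal.inv_two_add_inv_two, one_mul]

theorem le_mul_of_sq_le_add_mul {x y K : NNReal} (h : x ^ 2 ≤ y ^ 2 + 2 * K * (y * x)) :
    x ≤ (2 * K + 1) * y := by
  rcases le_or_gt x y with hxy | hxy
  · exact hxy.trans (le_mul_of_one_le_left y.2 (by simp))
  · have hx : 0 < x := y.2.trans_lt hxy
    refine le_of_mul_le_mul_right ?_ hx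
    calc x * x ≤ y * y + 2 * K * (y * x) := by simpa only [sq] using h
      _ ≤ y * x + 2 * K * (y * x) := by gcongr
      _ = (2 * K + 1) * y * x := by ring

/-- The polynomial `-i (P² - P(0)²)`. For `P` real at the origin it passes from `L^s` bounds to
`L^(2 * s)` bounds: its real part is `2 Re P Im P` and its imaginary part dominates
`(Im P)² - (Re P)²`. -/
def squareTwist (P : ℂ[X]) : ℂ[X] := C (-Complex.I) * (P ^ 2 - C (P.eval 0 ^ 2))

theorem eval_zero_squareTwist (P : ℂ[X]) : (squareTwist P).eval 0 = 0 := by simp [squareTwist]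

theorem rePoly_squareTwist {P : ℂ[X]} (hP : (P.eval 0).im = 0) (θ : UCircle) :
    rePoly (squareTwist P) θ = 2 * (rePoly P θ * imPoly P θ) := by
  simp only [rePoly_apply, imPoly_apply, circlePoly_apply, squareTwist, eval_mul, eval_C,
    eval_sub, sq, Complex.mul_re, Complex.mul_im, Complex.sub_re, Complex.sub_im,
    Complex.neg_re, Complex.neg_im, Complex.I_re, Complex.I_im, hP]
  ring

theorem imPoly_squareTwist {P : ℂ[X]} (hP : (P.eval 0).im = 0) (θ : UCircle) :
    imPoly (squareTwist P) θ = imPoly P θ ^ 2 - rePoly P θ ^ 2 + (P.eval 0).re ^ 2 := by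
  simp only [rePoly_apply, imPoly_apply, circlePoly_apply, squareTwist, eval_mul, eval_C,
    eval_sub, sq, Complex.mul_re, Complex.mul_im, Complex.sub_re, Complex.sub_im,
    Complex.neg_re, Complex.neg_im, Complex.I_re, Complex.I_im, hP]
  ring

theorem norm_imPoly_sq_le {P : ℂ[X]} (hP : (P.eval 0).im = 0) (θ : UCircle) :
    ‖imPoly P θ‖ ^ 2 ≤ ‖rePoly P θ‖ ^ 2 + ‖imPoly (squareTwist P) θ‖ := by
  have him := (Real.le_norm_self _).trans_eq' (imPoly_squareTwist hP θ)
  rw [Real.norm_eq_abs, Real.norm_eq_abs, sq_abs, sq_abs]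
  linarith [sq_nonneg (P.eval 0).re]

theorem RieszBound.eLpNorm_imPoly_squareTwist_le {s : ℝ≥0∞} {K : NNReal} (h : RieszBound s K)
    {P : ℂ[X]} (hP : (P.eval 0).im = 0) :
    eLpNorm (imPoly (squareTwist P)) s ell ≤
      2 * K * (eLpNorm (rePoly P) (2 * s) ell * eLpNorm (imPoly P) (2 * s) ell) := by
  have hre : (rePoly (squareTwist P) : UCircle → ℝ) =
      (2 : ℝ) • (⇑(rePoly P) * ⇑(imPoly P)) := funext (rePoly_squareTwist hP)
  calc eLpNorm (imPoly (squareTwist P)) s ell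
      ≤ K * eLpNorm (rePoly (squareTwist P)) s ell := h _ (by simp [eval_zero_squareTwist])
    _ = 2 * K * eLpNorm (⇑(rePoly P) * ⇑(imPoly P)) s ell := by
        rw [hre, eLpNorm_const_smul, show ‖(2 : ℝ)‖ₑ = 2 by simp [enorm_eq_nnnorm], ← mul_assoc,
          mul_comm 2 (K : ℝ≥0∞)]
    _ ≤ _ := by
        gcongr
        have := holderTriple_two_mul s
        exact eLpNorm_mul_le_mul_eLpNorm (aestronglyMeasurable_of_continuousMap _)
          (aestronglyMeasurable_of_continuousMap _)

theorem RieszBound.two_mul {s : ℝ≥0∞} {K : NNReal} (hs : 1 ≤ s) (h : RieszBound s K) :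
    RieszBound (2 * s) (2 * K + 1) := by
  intro P hP
  have hmeas (Q : ℂ[X]) := aestronglyMeasurable_of_continuousMap (imPoly Q)
  have hmeas' := aestronglyMeasurable_of_continuousMap (rePoly P)
  have hsq : eLpNorm (imPoly P) (2 * s) ell ^ 2 ≤ eLpNorm (rePoly P) (2 * s) ell ^ 2 +
      2 * K * (eLpNorm (rePoly P) (2 * s) ell * eLpNorm (imPoly P) (2 * s) ell) :=
    calc eLpNorm (imPoly P) (2 * s) ell ^ 2 = eLpNorm (fun θ => ‖imPoly P θ‖ ^ 2) s ell :=
          (eLpNorm_norm_sq_eq _ _).symm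
      _ ≤ eLpNorm ((fun θ => ‖rePoly P θ‖ ^ 2) + fun θ => ‖imPoly (squareTwist P) θ‖) s ell :=
          eLpNorm_mono_real fun θ => by
            rw [Real.norm_of_nonneg (by positivity)]
            exact norm_imPoly_sq_le hP θ
      _ ≤ eLpNorm (fun θ => ‖rePoly P θ‖ ^ 2) s ell +
            eLpNorm (fun θ => ‖imPoly (squareTwist P) θ‖) s ell :=
          eLpNorm_add_le (hmeas'.norm.pow 2) (hmeas _).norm hs
      _ ≤ _ := by
          rw [eLpNorm_norm_sq_eq, eLpNorm_norm]
          gcongr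
          exact h.eLpNorm_imPoly_squareTwist_le hP
  have hX : eLpNorm (imPoly P) (2 * s) ell ≠ ∞ := (memLp_of_continuousMap _ _).2.ne
  have hY : eLpNorm (rePoly P) (2 * s) ell ≠ ∞ := (memLp_of_continuousMap _ _).2.ne
  lift eLpNorm (imPoly P) (2 * s) ell to NNReal using hX with x
  lift eLpNorm (rePoly P) (2 * s) ell to NNReal using hY with y
  exact_mod_cast le_mul_of_sq_le_add_mul (mod_cast hsq)

theorem exists_rieszBound_Icc_ofReal {a : ℝ} (ha : 1 < a) (b : ℝ) :
    ∃ C : NNReal, ∀ s ∈ Set.Icc a b, RieszBound (ENNReal.ofReal s) C := by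
  obtain ⟨c, hc, hca, hc_le⟩ : ∃ c, 1 < c ∧ c ≤ a ∧ c ≤ 5 / 4 :=
    ⟨min a (5 / 4), lt_min ha (by norm_num), min_le_left _ _, min_le_right _ _⟩
  have hdyadic (n : ℕ) : ∃ C : NNReal, ∀ s ∈ Set.Icc c (5 / 2 * 2 ^ n),
      RieszBound (ENNReal.ofReal s) C := by
    induction n with
    | zero => simpa using exists_rieszBound_Icc_five_halves hc
    | succ n ih =>
      obtain ⟨K, hK⟩ := ih
      refine ⟨2 * K + 1, fun s hs => ?_⟩
      rcases le_total s (5 / 2 * 2 ^ n) with hle | hle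
      · exact (hK s ⟨hs.1, hle⟩).mono (le_add_right (le_mul_of_one_le_left K.2 one_le_two))
      · have hpow : (1 : ℝ) ≤ 2 ^ n := one_le_pow₀ one_le_two
        have hhalf : s / 2 ∈ Set.Icc c (5 / 2 * 2 ^ n) :=
          ⟨by linarith, by linarith [hs.2, pow_succ (2 : ℝ) n]⟩
        have hs_eq : ENNReal.ofReal s = 2 * ENNReal.ofReal (s / 2) := by
          rw [← ENNReal.ofReal_ofNat, ← ENNReal.ofReal_mul two_pos.le,
            mul_div_cancel₀ s two_ne_zero]
        rw [hs_eq]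
        exact (hK _ hhalf).two_mul (ENNReal.one_le_ofReal.2 (by linarith [hhalf.1]))
  obtain ⟨n, hn⟩ := pow_unbounded_of_one_lt b (one_lt_two (α := ℝ))
  obtain ⟨C, hC⟩ := hdyadic n
  refine ⟨C, fun s hs => hC s ⟨hca.trans hs.1, hs.2.trans ?_⟩⟩
  linarith [show (0 : ℝ) < 2 ^ n by positivity]

theorem exists_rieszBound_Icc {a b : ℝ≥0∞} (ha : 1 < a) (hb : b ≠ ∞) :
    ∃ C : NNReal, ∀ s ∈ Set.Icc a b, RieszBound s C := by
  rcases lt_or_ge b a with hba | hab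
  · exact ⟨0, fun s hs => absurd (hs.1.trans hs.2) hba.not_ge⟩
  lift b to NNReal using hb
  lift a to NNReal using (hab.trans_lt ENNReal.coe_lt_top).ne
  obtain ⟨C, hC⟩ := exists_rieszBound_Icc_ofReal (a := a) (by exact_mod_cast ha) b
  refine ⟨C, fun s hs => ?_⟩
  lift s to NNReal using (hs.2.trans_lt ENNReal.coe_lt_top).ne
  simpa using hC s ⟨by exact_mod_cast hs.1, by exact_mod_cast hs.2⟩

theorem exists_rieszBound {s : ℝ≥0∞} (hs : 1 < s) (hs_top : s ≠ ∞) :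
    ∃ C : NNReal, RieszBound s C := by
  obtain ⟨C, hC⟩ := exists_rieszBound_Icc hs hs_top
  exact ⟨C, hC s ⟨le_rfl, le_rfl⟩⟩

/-! ### Conjugate functions -/

theorem fourierCoeff_fourier_mul (m n : ℤ) (G : UCircle → ℂ) :
    fourierCoeff (⇑(fourier m) * G) n = fourierCoeff G (n - m) := by
  refine integral_congr_ae (.of_forall fun θ => ?_)
  simp only [Pi.mul_apply, smul_eq_mul, ← mul_assoc, ← fourier_add]
  congr 3
  ring

theorem fourierCoeff_circlePoly_mul {G : UCircle → ℂ} (hG : Integrable G ell)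
    (hneg : ∀ n < 0, fourierCoeff G n = 0) (P : ℂ[X]) {n : ℤ} (hn : n ≤ 0) :
    fourierCoeff (⇑(circlePoly P) * G) n = P.eval 0 * fourierCoeff G n := by
  have hint (Q : ℂ[X]) : Integrable (⇑(circlePoly Q) * G) ell :=
    hG.bdd_mul (aestronglyMeasurable_of_continuousMap _)
      (.of_forall (circlePoly Q).norm_coe_le_norm)
  induction P using Polynomial.induction_on' with
  | add P Q hP hQ =>
    rw [map_add, ContinuousMap.coe_add, add_mul, fourierCoeff.add (hint P) (hint Q), Pi.add_apply,
      hP, hQ, eval_add, add_mul]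
  | monomial m c =>
    rw [← C_mul_X_pow_eq_monomial, ← smul_eq_C_mul, map_smul, circlePoly_X_pow,
      ContinuousMap.coe_smul, smul_mul_assoc, fourierCoeff.const_smul, fourierCoeff_fourier_mul]
    rcases eq_or_ne m 0 with rfl | hm
    · simp
    · rw [hneg _ (by omega)]
      simp [hm]

theorem fourierCoeff_one (n : ℤ) : fourierCoeff (1 : UCircle → ℂ) n = if n = 0 then 1 else 0 := by
  have h := congrFun (fourierCoeff_fourier (T := 2 * Real.pi) 0) n
  have hone : ⇑(fourier (T := 2 * Real.pi) 0) = 1 := funext fun θ => fourier_zero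
  rw [← hone, h, Pi.single_apply]

theorem fourierCoeff_circlePoly (P : ℂ[X]) {n : ℤ} (hn : n ≤ 0) :
    fourierCoeff (circlePoly P) n = if n = 0 then P.eval 0 else 0 := by
  have h := fourierCoeff_circlePoly_mul (integrable_const 1)
    (fun n hn => (fourierCoeff_one n).trans (if_neg hn.ne)) P hn
  rwa [show (fun _ : UCircle => (1 : ℂ)) = 1 from rfl, mul_one,
    fourierCoeff_one, mul_ite, mul_one, mul_zero] at h

theorem fourierCoeff_zero_eq_integral (G : UCircle → ℂ) : fourierCoeff G 0 = ∫ θ, G θ ∂ell := by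
  simp [fourierCoeff]

theorem tendsto_fourierCoeff {ι : Type*} {l : Filter ι} {s : ℝ≥0∞} (hs : 1 ≤ s)
    {G : UCircle → ℂ} {F : ι → UCircle → ℂ}
    (hG : MemLp G s ell) (hF : ∀ i, MemLp (F i) s ell)
    (h : Tendsto (fun i => eLpNorm (F i - G) s ell) l (𝓝 0)) (n : ℤ) :
    Tendsto (fun i => fourierCoeff (F i) n) l (𝓝 (fourierCoeff G n)) := by
  refine tendsto_integral_of_L1' _ ((hG.integrable hs).fourier_smul _).1
    (.of_forall fun i => ((hF i).integrable hs).fourier_smul _) ?_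
  refine tendsto_of_tendsto_of_tendsto_of_le_of_le tendsto_const_nhds h (fun _ => zero_le)
    fun i => ?_
  calc _ = eLpNorm (F i - G) 1 ell := eLpNorm_congr_norm_ae <| .of_forall fun θ => by
        simp only [Pi.sub_apply, ← smul_sub, norm_smul, norm_fourier_apply, one_mul]
    _ ≤ eLpNorm (F i - G) s ell :=
        eLpNorm_le_eLpNorm_of_exponent_le hs ((hF i).sub hG).1

theorem fourierCoeff_ofReal_neg (h : UCircle → ℝ) (n : ℤ) :
    fourierCoeff (fun θ => (h θ : ℂ)) (-n) = conj (fourierCoeff (fun θ => (h θ : ℂ)) n) := by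
  rw [fourierCoeff, fourierCoeff, ← integral_conj]
  simp only [smul_eq_mul, map_mul, Complex.conj_ofReal, ← fourier_neg]

theorem fourierCoeff_add_I_mul {h k : UCircle → ℝ} (hh : Integrable h ell)
    (hk : Integrable k ell) (n : ℤ) :
    fourierCoeff (fun θ => (h θ : ℂ) + Complex.I * k θ) n =
      fourierCoeff (fun θ => (h θ : ℂ)) n + Complex.I * fourierCoeff (fun θ => (k θ : ℂ)) n := by
  rw [← fourierCoeff.const_mul]
  exact congrFun (fourierCoeff.add hh.ofReal (hk.ofReal.const_mul Complex.I)) n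

theorem fourierCoeff_ofReal_zero (h : UCircle → ℝ) :
    fourierCoeff (fun θ => (h θ : ℂ)) 0 = (∫ θ, h θ ∂ell : ℝ) := by
  rw [fourierCoeff_zero_eq_integral, integral_complex_ofReal]

theorem IsConjugate.integral_eq_zero {h k : UCircle → ℝ} (hk : IsConjugate h k) :
    ∫ θ, k θ ∂ell = 0 := by
  have h0 := hk.2 0
  rw [fourierCoeff_ofReal_zero] at h0
  simpa using h0

theorem IsConjugate.fourierCoeff_add_I_mul_of_neg {h k : UCircle → ℝ} (hk : IsConjugate h k)
    (hh : Integrable h ell) {n : ℤ} (hn : n < 0) :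
    fourierCoeff (fun θ => (h θ : ℂ) + Complex.I * k θ) n = 0 := by
  rw [fourierCoeff_add_I_mul hh hk.1, hk.2, Int.sign_eq_neg_one_of_neg hn]
  push_cast
  linear_combination fourierCoeff (fun θ => (h θ : ℂ)) n * Complex.I_mul_I

theorem isConjugate_of_fourierCoeff {h k : UCircle → ℝ} (hh : Integrable h ell)
    (hk : Integrable k ell)
    (hneg : ∀ n < 0, fourierCoeff (fun θ => (h θ : ℂ) + Complex.I * k θ) n = 0)
    (hzero : ∫ θ, k θ ∂ell = 0) : IsConjugate h k := by
  have hcoeff (n : ℤ) (hn : n < 0) : fourierCoeff (fun θ => (k θ : ℂ)) n =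
      Complex.I * fourierCoeff (fun θ => (h θ : ℂ)) n := by
    have h0 := hneg n hn
    rw [fourierCoeff_add_I_mul hh hk] at h0
    linear_combination -Complex.I * h0 + fourierCoeff (fun θ => (k θ : ℂ)) n * Complex.I_mul_I
  refine ⟨hk, fun n => ?_⟩
  rcases lt_trichotomy n 0 with hn | rfl | hn
  · rw [hcoeff n hn, Int.sign_eq_neg_one_of_neg hn]
    push_cast
    ring
  · simp [fourierCoeff_ofReal_zero, hzero]
  · have hconj := congrArg conj (hcoeff (-n) (by omega))
    rw [map_mul, fourierCoeff_ofReal_neg, fourierCoeff_ofReal_neg, Complex.conj_conj,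
      Complex.conj_conj, Complex.conj_I] at hconj
    rw [hconj, Int.sign_eq_one_of_pos hn]
    push_cast
    ring

/-- The polynomials `P n`, real at the origin, approximate `u` in `L^s` of the circle. -/
structure IsHardyApprox (s : ℝ≥0∞) (P : ℕ → ℂ[X]) (u : UCircle → ℂ) : Prop where
  im_eval_zero (n : ℕ) : ((P n).eval 0).im = 0
  memLp : MemLp u s ell
  tendsto : Tendsto (fun n => eLpNorm (⇑(circlePoly (P n)) - u) s ell) atTop (𝓝 0)

section

variable {s : ℝ≥0∞} {P : ℕ → ℂ[X]} {u : UCircle → ℂ}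

theorem IsHardyApprox.tendsto_fourierCoeff (h : IsHardyApprox s P u) (hs : 1 ≤ s) (n : ℤ) :
    Tendsto (fun m => fourierCoeff (circlePoly (P m)) n) atTop (𝓝 (fourierCoeff u n)) :=
  _root_.tendsto_fourierCoeff hs h.memLp (fun _ => memLp_of_continuousMap _ s) h.tendsto n

theorem IsHardyApprox.fourierCoeff_of_neg (h : IsHardyApprox s P u) (hs : 1 ≤ s) {n : ℤ}
    (hn : n < 0) : fourierCoeff u n = 0 :=
  tendsto_nhds_unique (h.tendsto_fourierCoeff hs n) <| tendsto_const_nhds.congr fun m => by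
    rw [fourierCoeff_circlePoly _ hn.le, if_neg hn.ne]

theorem IsHardyApprox.tendsto_eval_zero (h : IsHardyApprox s P u) (hs : 1 ≤ s) :
    Tendsto (fun n => (P n).eval 0) atTop (𝓝 (∫ θ, u θ ∂ell)) := by
  rw [← fourierCoeff_zero_eq_integral]
  refine (h.tendsto_fourierCoeff hs 0).congr fun n => ?_
  rw [fourierCoeff_circlePoly _ le_rfl, if_pos rfl]

theorem IsHardyApprox.im_integral_eq_zero (h : IsHardyApprox s P u) (hs : 1 ≤ s) :
    (∫ θ, u θ ∂ell).im = 0 :=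
  tendsto_nhds_unique ((Complex.continuous_im.tendsto _).comp (h.tendsto_eval_zero hs))
    (tendsto_const_nhds.congr fun n => (h.im_eval_zero n).symm)

theorem IsHardyApprox.isConjugate (h : IsHardyApprox s P u) (hs : 1 ≤ s) :
    IsConjugate (fun θ => (u θ).re) (fun θ => (u θ).im) := by
  have hu := h.memLp.integrable hs
  refine isConjugate_of_fourierCoeff hu.re hu.im (fun n hn => ?_) ?_
  · simp_rw [mul_comm Complex.I, Complex.re_add_im]
    exact h.fourierCoeff_of_neg hs hn
  · exact (integral_im hu).trans (h.im_integral_eq_zero hs)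

theorem IsHardyApprox.integral_mul {r : ℝ≥0∞} [ENNReal.HolderConjugate r s]
    (h : IsHardyApprox s P u) {G : UCircle → ℂ} (hG : MemHardy r G) :
    ∫ θ, G θ * u θ ∂ell = (∫ θ, G θ ∂ell) * ∫ θ, u θ ∂ell := by
  have hr : 1 ≤ r := ENNReal.HolderConjugate.one_le r s
  have hs : 1 ≤ s := ENNReal.HolderConjugate.one_le s r
  have hpoly (n : ℕ) : ∫ θ, G θ * circlePoly (P n) θ ∂ell = (∫ θ, G θ ∂ell) * (P n).eval 0 := by
    have h0 := fourierCoeff_circlePoly_mul (hG.1.integrable hr) hG.2 (P n) le_rfl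
    simp only [fourierCoeff_zero_eq_integral, Pi.mul_apply] at h0
    simp_rw [mul_comm (G _), h0, mul_comm]
  have hlim : Tendsto (fun n => ∫ θ, G θ * circlePoly (P n) θ ∂ell) atTop
      (𝓝 (∫ θ, G θ * u θ ∂ell)) := by
    refine tendsto_integral_of_L1' _ (hG.1.integrable_mul h.memLp).1
      (.of_forall fun n => hG.1.integrable_mul (memLp_of_continuousMap _ s)) ?_
    refine tendsto_of_tendsto_of_tendsto_of_le_of_le tendsto_const_nhds
      (by simpa using ENNReal.Tendsto.const_mul h.tendsto (.inr hG.1.2.ne)) (fun _ => zero_le)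
      fun n => ?_
    rw [show (fun θ => G θ * circlePoly (P n) θ) = G * ⇑(circlePoly (P n)) from rfl]
    simpa only [mul_sub] using eLpNorm_mul_le_mul_eLpNorm hG.1.1
      ((aestronglyMeasurable_of_continuousMap _).sub h.memLp.1)
  exact tendsto_nhds_unique (hlim.congr hpoly) ((h.tendsto_eval_zero hs).const_mul _)

end

theorem exists_continuousMap_eLpNorm_sub_le {s : ℝ≥0∞} (hs : s ≠ ∞) {h : UCircle → ℝ}
    (hh : MemLp h s ell) {ε : ℝ≥0∞} (hε : ε ≠ 0) :
    ∃ φ : C(UCircle, ℝ), eLpNorm (⇑φ - h) s ell ≤ ε ∧ ∀ θ, ‖φ θ‖ₑ ≤ eLpNorm h ∞ ell := by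
  obtain ⟨g, hg, -⟩ := hh.exists_boundedContinuous_eLpNorm_sub_le hs hε
  rw [eLpNorm_sub_comm] at hg
  have hbound : ∀ᵐ θ ∂ell, ‖h θ‖ₑ ≤ eLpNorm h ∞ ell := by
    rw [eLpNorm_exponent_top]
    exact ae_le_eLpNormEssSup
  rcases eq_or_ne (eLpNorm h ∞ ell) ∞ with htop | htop
  · exact ⟨g.toContinuousMap, hg, fun θ => by rw [htop]; exact le_top⟩
  lift eLpNorm h ∞ ell to NNReal using htop with M
  have habs {x : ℝ} : ‖x‖ₑ ≤ M ↔ |x| ≤ M := by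
    rw [enorm_le_coe, ← NNReal.coe_le_coe, coe_nnnorm, Real.norm_eq_abs]
  have hM : -(M : ℝ) ≤ M := neg_le_self M.2
  refine ⟨⟨fun θ => Set.projIcc _ _ hM (g θ), by fun_prop⟩, (eLpNorm_mono_ae ?_).trans hg,
    fun θ => habs.2 (abs_le.2 (Set.projIcc _ _ hM (g θ)).2)⟩
  filter_upwards [hbound] with θ hθ
  have hclamp : (Set.projIcc _ _ hM (h θ) : ℝ) = h θ :=
    congrArg Subtype.val (Set.projIcc_of_mem hM (abs_le.1 (habs.1 hθ)))
  calc ‖(Set.projIcc _ _ hM (g θ) : ℝ) - h θ‖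
      = |(Set.projIcc _ _ hM (g θ) : ℝ) - Set.projIcc _ _ hM (h θ)| := by
        rw [hclamp, Real.norm_eq_abs]
    _ ≤ ‖g θ - h θ‖ := Set.abs_projIcc_sub_projIcc hM

theorem eLpNorm_le_of_forall_norm_le {E : Type*} [NormedAddCommGroup E] {φ : UCircle → E}
    {ε : NNReal} (h : ∀ θ, ‖φ θ‖ ≤ ε) (s : ℝ≥0∞) : eLpNorm φ s ell ≤ ε := by
  simpa using eLpNorm_le_of_ae_nnnorm_bound (p := s) (μ := ell) (.of_forall h)

theorem exists_rePoly_eLpNorm_sub_le {s : ℝ≥0∞} (hs : 1 ≤ s) (hs_top : s ≠ ∞) {h : UCircle → ℝ}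
    (hh : MemLp h s ell) {ε : NNReal} (hε : 0 < ε) :
    ∃ P : ℂ[X], (P.eval 0).im = 0 ∧ eLpNorm (⇑(rePoly P) - h) s ell ≤ ε ∧
      ∀ θ, ‖rePoly P θ‖ₑ ≤ eLpNorm h ∞ ell + ε := by
  obtain ⟨φ, hφ, hφM⟩ := exists_continuousMap_eLpNorm_sub_le hs_top hh
    (ε := (ε / 2 : NNReal)) (by simpa using hε.ne')
  obtain ⟨P, hP, hPφ⟩ := exists_rePoly_near φ (NNReal.coe_pos.2 (half_pos hε))
  refine ⟨P, hP, ?_, fun θ => ?_⟩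
  · calc eLpNorm (⇑(rePoly P) - h) s ell = eLpNorm ((⇑(rePoly P) - ⇑φ) + (⇑φ - h)) s ell := by
          rw [sub_add_sub_cancel]
      _ ≤ eLpNorm (⇑(rePoly P) - ⇑φ) s ell + eLpNorm (⇑φ - h) s ell :=
          eLpNorm_add_le (aestronglyMeasurable_of_continuousMap (rePoly P - φ))
            ((aestronglyMeasurable_of_continuousMap φ).sub hh.1) hs
      _ ≤ (ε / 2 : NNReal) + (ε / 2 : NNReal) :=
          add_le_add (eLpNorm_le_of_forall_norm_le (fun θ => (hPφ θ).le) s) hφ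
      _ = ε := by rw [← ENNReal.coe_add, add_halves]
  · have hdist : ‖rePoly P θ - φ θ‖ₑ ≤ ε :=
      enorm_le_coe.2 <| NNReal.coe_le_coe.1 <| (hPφ θ).le.trans (half_le_self ε.2)
    calc ‖rePoly P θ‖ₑ = ‖φ θ + (rePoly P θ - φ θ)‖ₑ := by rw [add_sub_cancel]
      _ ≤ ‖φ θ‖ₑ + ‖rePoly P θ - φ θ‖ₑ := enorm_add_le _ _
      _ ≤ eLpNorm h ∞ ell + ε := add_le_add (hφM θ) hdist

theorem RieszBound.exists_tendsto_imPoly {s : ℝ≥0∞} {K : NNReal} (hK : RieszBound s K)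
    (hs : 1 ≤ s) {h : UCircle → ℝ} (hh : MemLp h s ell) {P : ℕ → ℂ[X]}
    (hP : ∀ n, ((P n).eval 0).im = 0)
    (hlim : Tendsto (fun n => eLpNorm (⇑(rePoly (P n)) - h) s ell) atTop (𝓝 0)) :
    ∃ k : UCircle → ℝ, MemLp k s ell ∧
      Tendsto (fun n => eLpNorm (⇑(imPoly (P n)) - k) s ell) atTop (𝓝 0) := by
  have : Fact (1 ≤ s) := ⟨hs⟩
  have hre (Q : ℂ[X]) : MemLp (rePoly Q) s ell := memLp_of_continuousMap _ s
  have him (Q : ℂ[X]) : MemLp (imPoly Q) s ell := memLp_of_continuousMap _ s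
  have hle (n m : ℕ) : edist (him (P n)).toLp (him (P m)).toLp ≤
      K * edist (hre (P n)).toLp (hre (P m)).toLp := by
    rw [Lp.edist_toLp_toLp, Lp.edist_toLp_toLp, ← ContinuousMap.coe_sub, ← ContinuousMap.coe_sub,
      ← map_sub, ← map_sub]
    exact hK _ (by simp [hP])
  have hcauchy_re : CauchySeq fun n => (hre (P n)).toLp :=
    ((Lp.tendsto_Lp_iff_tendsto_eLpNorm'' _ (fun n => hre (P n)) h hh).2 hlim).cauchySeq
  have hcauchy_im : CauchySeq fun n => (him (P n)).toLp := by
    refine EMetric.cauchySeq_iff.2 fun ε hε => ?_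
    obtain ⟨N, hN⟩ := EMetric.cauchySeq_iff.1 hcauchy_re (ε / K)
      (ENNReal.div_pos hε.ne' ENNReal.coe_ne_top)
    exact ⟨N, fun m hm n hn => (hle m n).trans_lt (ENNReal.mul_lt_of_lt_div' (hN m hm n hn))⟩
  obtain ⟨k, hk⟩ := cauchySeq_tendsto_of_complete hcauchy_im
  refine ⟨k, Lp.memLp k, ?_⟩
  rw [← Lp.tendsto_Lp_iff_tendsto_eLpNorm'' _ (fun n => him (P n)) _ (Lp.memLp k)]
  simpa using hk

theorem RieszBound.exists_isHardyApprox {s : ℝ≥0∞} {K : NNReal} (hK : RieszBound s K) (hs : 1 ≤ s)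
    (hs_top : s ≠ ∞) {h : UCircle → ℝ} (hh : MemLp h s ell) :
    ∃ (P : ℕ → ℂ[X]) (k : UCircle → ℝ), IsHardyApprox s P (fun θ => h θ + Complex.I * k θ) ∧
      ∀ n θ, ‖rePoly (P n) θ‖ₑ ≤ eLpNorm h ∞ ell + 1 := by
  choose P hP0 hPh hPM using fun n : ℕ =>
    exists_rePoly_eLpNorm_sub_le hs hs_top hh (ε := 1 / ((n : NNReal) + 1)) (by positivity)
  have hε : Tendsto (fun n : ℕ => ((1 / ((n : NNReal) + 1) : NNReal) : ℝ≥0∞)) atTop (𝓝 0) :=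
    ENNReal.tendsto_coe.2 tendsto_one_div_add_atTop_nhds_zero_nat
  have hlim : Tendsto (fun n => eLpNorm (⇑(rePoly (P n)) - h) s ell) atTop (𝓝 0) :=
    tendsto_of_tendsto_of_tendsto_of_le_of_le tendsto_const_nhds hε (fun _ => zero_le) hPh
  obtain ⟨k, hk, hklim⟩ := hK.exists_tendsto_imPoly hs hh hP0 hlim
  have hu : MemLp (fun θ => (h θ : ℂ) + Complex.I * k θ) s ell :=
    (hh.ofReal (K := ℂ)).add ((hk.ofReal (K := ℂ)).const_mul Complex.I)
  refine ⟨P, k, ⟨hP0, hu, ?_⟩, fun n θ => ?_⟩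
  · refine tendsto_of_tendsto_of_tendsto_of_le_of_le tendsto_const_nhds
      (by simpa only [add_zero] using hlim.add hklim) (fun _ => zero_le) fun n => ?_
    have hre : MemLp (⇑(rePoly (P n)) - h) s ell := (memLp_of_continuousMap _ s).sub hh
    have him : MemLp (⇑(imPoly (P n)) - k) s ell := (memLp_of_continuousMap _ s).sub hk
    calc eLpNorm (⇑(circlePoly (P n)) - fun θ => h θ + Complex.I * k θ) s ell
        ≤ eLpNorm ((fun θ => ‖(⇑(rePoly (P n)) - h) θ‖) +
            fun θ => ‖(⇑(imPoly (P n)) - k) θ‖) s ell := by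
          refine eLpNorm_mono_real fun θ => (Complex.norm_le_abs_re_add_abs_im _).trans_eq ?_
          simp [rePoly_apply, imPoly_apply]
      _ ≤ eLpNorm (⇑(rePoly (P n)) - h) s ell + eLpNorm (⇑(imPoly (P n)) - k) s ell := by
          simpa only [eLpNorm_norm] using eLpNorm_add_le hre.1.norm him.1.norm hs
  · refine (hPM n θ).trans (add_le_add_right (ENNReal.coe_le_one_iff.2 ?_) _)
    exact div_le_one_of_le₀ (le_add_of_nonneg_left zero_le) zero_le

theorem tendsto_eLpNorm {α ι E : Type*} [MeasurableSpace α] {μ : Measure α}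
    [NormedAddCommGroup E] {l : Filter ι} {s : ℝ≥0∞} (hs : 1 ≤ s) {G : α → E} {F : ι → α → E}
    (hG : MemLp G s μ) (hF : ∀ i, MemLp (F i) s μ)
    (h : Tendsto (fun i => eLpNorm (F i - G) s μ) l (𝓝 0)) :
    Tendsto (fun i => eLpNorm (F i) s μ) l (𝓝 (eLpNorm G s μ)) := by
  have : Fact (1 ≤ s) := ⟨hs⟩
  have hlim := ((Lp.tendsto_Lp_iff_tendsto_eLpNorm'' F hF G hG).2 h).enorm
  simpa only [Lp.enorm_toLp] using hlim

theorem RieszBound.eLpNorm_im_le {s : ℝ≥0∞} {K : NNReal} (hK : RieszBound s K) (hs : 1 ≤ s)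
    {P : ℕ → ℂ[X]} {u : UCircle → ℂ} (hu : IsHardyApprox s P u) :
    eLpNorm (fun θ => (u θ).im) s ell ≤ K * eLpNorm (fun θ => (u θ).re) s ell := by
  have hre : Tendsto (fun n => eLpNorm (rePoly (P n)) s ell) atTop
      (𝓝 (eLpNorm (fun θ => (u θ).re) s ell)) :=
    tendsto_eLpNorm hs hu.memLp.re (fun n => memLp_of_continuousMap _ s) <|
      tendsto_of_tendsto_of_tendsto_of_le_of_le tendsto_const_nhds hu.tendsto (fun _ => zero_le)
        fun n => eLpNorm_mono fun θ => Complex.abs_re_le_norm ((⇑(circlePoly (P n)) - u) θ)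
  have him : Tendsto (fun n => eLpNorm (imPoly (P n)) s ell) atTop
      (𝓝 (eLpNorm (fun θ => (u θ).im) s ell)) :=
    tendsto_eLpNorm hs hu.memLp.im (fun n => memLp_of_continuousMap _ s) <|
      tendsto_of_tendsto_of_tendsto_of_le_of_le tendsto_const_nhds hu.tendsto (fun _ => zero_le)
        fun n => eLpNorm_mono fun θ => Complex.abs_im_le_norm ((⇑(circlePoly (P n)) - u) θ)
  exact le_of_tendsto_of_tendsto' him
    (ENNReal.Tendsto.const_mul hre (.inr ENNReal.coe_ne_top)) fun n => hK _ (hu.im_eval_zero n)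

/-- `C` bounds the conjugation operator on the real space `L^s` of the circle; the infimum of such
`C` is `conjugationNorm s`. -/
def IsConjugationBound (s C : ℝ≥0∞) : Prop :=
  ∀ h : UCircle → ℝ, MemLp h s ell →
    ∃ k : UCircle → ℝ, IsConjugate h k ∧ eLpNorm k s ell ≤ C * eLpNorm h s ell

theorem RieszBound.isConjugationBound {s : ℝ≥0∞} {K : NNReal} (hK : RieszBound s K) (hs : 1 ≤ s)
    (hs_top : s ≠ ∞) : IsConjugationBound s K := by
  intro h hh
  obtain ⟨P, k, hPk, -⟩ := hK.exists_isHardyApprox hs hs_top hh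
  exact ⟨k, by simpa using hPk.isConjugate hs, by simpa using hK.eLpNorm_im_le hs hPk⟩

theorem conjugationNorm_ne_top {s : ℝ≥0∞} (hs : 1 < s) (hs_top : s ≠ ∞) :
    conjugationNorm s ≠ ∞ := by
  obtain ⟨K, hK⟩ := exists_rieszBound hs hs_top
  exact ((sInf_le (hK.isConjugationBound hs.le hs_top)).trans_lt ENNReal.coe_lt_top).ne

/-! ### Exponential multipliers -/

/-- `u` is almost everywhere the limit of a sequence of polynomials whose real parts are uniformly
bounded on the circle. This is what makes `exp u` a bounded multiplier of the Hardy spaces. -/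
def IsBoundedReLimit (u : UCircle → ℂ) : Prop :=
  ∃ (P : ℕ → ℂ[X]) (M : ℝ), (∀ n θ, |rePoly (P n) θ| ≤ M) ∧
    ∀ᵐ θ ∂ell, Tendsto (fun n => circlePoly (P n) θ) atTop (𝓝 (u θ))

theorem IsHardyApprox.isBoundedReLimit {s : ℝ≥0∞} {P : ℕ → ℂ[X]} {u : UCircle → ℂ}
    (h : IsHardyApprox s P u) (hs : s ≠ 0) {M : ℝ} (hM : ∀ n θ, |rePoly (P n) θ| ≤ M) :
    IsBoundedReLimit u := by
  obtain ⟨ns, -, hns⟩ := (tendstoInMeasure_of_tendsto_eLpNorm hs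
    (fun _ => aestronglyMeasurable_of_continuousMap _) h.memLp.1 h.tendsto).exists_seq_tendsto_ae
  exact ⟨P ∘ ns, M, fun n => hM (ns n), hns⟩

theorem exists_isHardyApprox_isBoundedReLimit {s : ℝ≥0∞} (hs : 1 < s) (hs_top : s ≠ ∞)
    {w : UCircle → ℝ} (hw : MemLp w ∞ ell) : ∃ (P : ℕ → ℂ[X]) (k : UCircle → ℝ),
      IsHardyApprox s P (fun θ => w θ + Complex.I * k θ) ∧
        IsBoundedReLimit fun θ => w θ + Complex.I * k θ := by
  obtain ⟨K, hK⟩ := exists_rieszBound hs hs_top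
  obtain ⟨P, k, hPk, hP⟩ := hK.exists_isHardyApprox hs.le hs_top (hw.mono_exponent le_top)
  have hM : eLpNorm w ∞ ell + 1 ≠ ∞ := ENNReal.add_ne_top.2 ⟨hw.2.ne, ENNReal.one_ne_top⟩
  refine ⟨P, k, hPk, hPk.isBoundedReLimit (zero_lt_one.trans hs).ne'
    (M := (eLpNorm w ∞ ell + 1).toReal) fun n θ => ?_⟩
  simpa using ENNReal.toReal_mono hM (hP n θ)

section

variable {u G : UCircle → ℂ}

theorem IsBoundedReLimit.real_mul (hu : IsBoundedReLimit u) (t : ℝ) :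
    IsBoundedReLimit fun θ => t * u θ := by
  obtain ⟨P, M, hM, hlim⟩ := hu
  refine ⟨fun n => t • P n, |t| * M, fun n θ => ?_, ?_⟩
  · rw [map_smul, ContinuousMap.smul_apply, smul_eq_mul, abs_mul]
    exact mul_le_mul_of_nonneg_left (hM n θ) (abs_nonneg t)
  · filter_upwards [hlim] with θ hθ
    simpa [← Complex.coe_smul, map_smul] using hθ.const_mul (t : ℂ)

theorem IsBoundedReLimit.aestronglyMeasurable (hu : IsBoundedReLimit u) :
    AEStronglyMeasurable u ell := by
  obtain ⟨P, M, -, hlim⟩ := hu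
  exact aestronglyMeasurable_of_tendsto_ae atTop
    (fun n => aestronglyMeasurable_of_continuousMap (circlePoly (P n))) hlim

theorem IsBoundedReLimit.exists_abs_re_le (hu : IsBoundedReLimit u) :
    ∃ M : ℝ, ∀ᵐ θ ∂ell, |(u θ).re| ≤ M := by
  obtain ⟨P, M, hM, hlim⟩ := hu
  refine ⟨M, ?_⟩
  filter_upwards [hlim] with θ hθ
  exact le_of_tendsto' ((Complex.continuous_re.tendsto _).comp hθ).abs fun n => hM n θ

theorem tendsto_fourierCoeff_of_dominated {F : ℕ → UCircle → ℂ} {b : UCircle → ℝ}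
    (hF : ∀ n, AEStronglyMeasurable (F n) ell) (hb : Integrable b ell)
    (hFb : ∀ n, ∀ᵐ θ ∂ell, ‖F n θ‖ ≤ b θ)
    (hlim : ∀ᵐ θ ∂ell, Tendsto (fun n => F n θ) atTop (𝓝 (G θ))) (m : ℤ) :
    Tendsto (fun n => fourierCoeff (F n) m) atTop (𝓝 (fourierCoeff G m)) := by
  refine tendsto_integral_of_dominated_convergence b
    (fun n => (aestronglyMeasurable_of_continuousMap (fourier (-m))).smul (hF n)) hb
    (fun n => ?_) ?_
  · filter_upwards [hFb n] with θ hθ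
    rwa [norm_smul, norm_fourier_apply, one_mul]
  · filter_upwards [hlim] with θ hθ
    exact hθ.const_smul _

theorem norm_one_add_div_pow_le_exp_norm (z : ℂ) (n : ℕ) :
    ‖(1 + z / n) ^ n‖ ≤ Real.exp ‖z‖ := by
  rcases eq_or_ne n 0 with rfl | hn
  · simp
  calc ‖(1 + z / n) ^ n‖ = ‖1 + z / n‖ ^ n := norm_pow _ _
    _ ≤ Real.exp (‖z‖ / n) ^ n := by
        gcongr
        calc ‖1 + z / n‖ ≤ 1 + ‖z‖ / n := by simpa using norm_add_le 1 (z / n)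
          _ ≤ Real.exp (‖z‖ / n) := by linarith [Real.add_one_le_exp (‖z‖ / n)]
    _ = Real.exp ‖z‖ := by
        rw [← Real.exp_nat_mul, mul_div_cancel₀ _ (Nat.cast_ne_zero.2 hn)]

theorem fourierCoeff_mul_exp_circlePoly (hG : Integrable G ell)
    (hneg : ∀ n < 0, fourierCoeff G n = 0) (P : ℂ[X]) {n : ℤ} (hn : n < 0) :
    fourierCoeff (fun θ => G θ * Complex.exp (circlePoly P θ)) n = 0 := by
  have happly (m : ℕ) (θ : UCircle) : circlePoly ((1 + (m : ℂ)⁻¹ • P) ^ m) θ =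
      (1 + circlePoly P θ / m) ^ m := by
    simp [div_eq_inv_mul]
  have hlim := tendsto_fourierCoeff_of_dominated (m := n)
    (F := fun m => ⇑(circlePoly ((1 + (m : ℂ)⁻¹ • P) ^ m)) * G)
    (G := fun θ => G θ * Complex.exp (circlePoly P θ))
    (fun m => (aestronglyMeasurable_of_continuousMap _).mul hG.1)
    (hG.norm.const_mul (Real.exp ‖circlePoly P‖)) (fun m => .of_forall fun θ => ?_)
    (.of_forall fun θ => ?_)
  · refine tendsto_nhds_unique hlim (tendsto_const_nhds.congr fun m => ?_)
    rw [fourierCoeff_circlePoly_mul hG hneg _ hn.le, hneg n hn, mul_zero]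
  · rw [Pi.mul_apply, norm_mul, happly]
    gcongr
    exact (norm_one_add_div_pow_le_exp_norm _ m).trans
      (Real.exp_le_exp.2 ((circlePoly P).norm_coe_le_norm θ))
  · simp only [Pi.mul_apply, happly, mul_comm (G θ)]
    exact (Complex.tendsto_one_add_div_pow_exp _).mul_const _

theorem IsBoundedReLimit.memHardy_mul_exp (hu : IsBoundedReLimit u) {p : ℝ≥0∞} (hp : 1 ≤ p)
    (hG : MemHardy p G) : MemHardy p fun θ => G θ * Complex.exp (u θ) := by
  have hGint := hG.1.integrable hp
  constructor
  · obtain ⟨M, hM⟩ := hu.exists_abs_re_le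
    refine hG.1.of_le_mul (c := Real.exp M)
      (hG.1.1.mul (Complex.continuous_exp.comp_aestronglyMeasurable hu.aestronglyMeasurable)) ?_
    filter_upwards [hM] with θ hθ
    rw [norm_mul, Complex.norm_exp, mul_comm]
    gcongr
    exact (le_abs_self _).trans hθ
  · intro n hn
    obtain ⟨P, M, hM, hlim⟩ := hu
    have hcoeff := tendsto_fourierCoeff_of_dominated (m := n)
      (F := fun m θ => G θ * Complex.exp (circlePoly (P m) θ))
      (G := fun θ => G θ * Complex.exp (u θ))
      (fun m => hG.1.1.mul
        (Complex.continuous_exp.comp (circlePoly (P m)).continuous).aestronglyMeasurable)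
      (hGint.norm.const_mul (Real.exp M)) (fun m => .of_forall fun θ => ?_) ?_
    · refine tendsto_nhds_unique hcoeff (tendsto_const_nhds.congr fun m => ?_)
      exact (fourierCoeff_mul_exp_circlePoly hGint hG.2 (P m) hn).symm
    · rw [norm_mul, Complex.norm_exp, mul_comm]
      gcongr
      exact (le_abs_self _).trans (hM m θ)
    · filter_upwards [hlim] with θ hθ
      exact ((Complex.continuous_exp.tendsto _).comp hθ).const_mul _

end

/-! ### First-order condition for the extremal problem -/

theorem hasDerivAt_integral_mul_exp {α : Type*} [MeasurableSpace α] {μ : Measure α} {φ u : α → ℂ}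
    {M : ℝ} (hφ : Integrable φ μ) (hu : AEStronglyMeasurable u μ)
    (hφu : Integrable (fun x => φ x * u x) μ) (hM : ∀ᵐ x ∂μ, |(u x).re| ≤ M) :
    HasDerivAt (fun t : ℝ => ∫ x, φ x * Complex.exp (t * u x) ∂μ) (∫ x, φ x * u x ∂μ) 0 := by
  have hmeas (t : ℝ) : AEStronglyMeasurable (fun x => Complex.exp (t * u x)) μ :=
    Complex.continuous_exp.comp_aestronglyMeasurable (hu.const_mul _)
  have hderiv := hasDerivAt_integral_of_dominated_loc_of_deriv_le (𝕜 := ℝ) (μ := μ) (x₀ := 0)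
    (F := fun t x => φ x * Complex.exp (t * u x))
    (F' := fun t x => φ x * u x * Complex.exp (t * u x))
    (bound := fun x => ‖φ x * u x‖ * Real.exp M) (Metric.ball_mem_nhds 0 one_pos)
    (.of_forall fun t => hφ.1.mul (hmeas t)) (by simpa using hφ) (hφu.1.mul (hmeas 0)) ?_
    (hφu.norm.mul_const _) (.of_forall fun x t _ => ?_)
  · simpa using hderiv.2
  · filter_upwards [hM] with x hx t ht
    rw [norm_mul, Complex.norm_exp, Complex.re_ofReal_mul]
    gcongr
    calc t * (u x).re ≤ |t| * |(u x).re| := (le_abs_self _).trans_eq (abs_mul _ _)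
      _ ≤ 1 * M := by
          gcongr
          simpa using (Metric.mem_ball.1 ht).le
      _ = M := one_mul M
  · have hlin : HasDerivAt (fun t : ℝ => (t : ℂ) * u x) (u x) t := by
      simpa using (Complex.ofRealCLM.hasDerivAt (x := t)).mul_const (u x)
    simpa [mul_assoc, mul_comm (u x)] using hlin.cexp.const_mul (φ x)

theorem hasDerivAt_integral_mul_rexp {α : Type*} [MeasurableSpace α] {μ : Measure α} {φ v : α → ℝ}
    {M : ℝ} (hφ : Integrable φ μ) (hv : AEStronglyMeasurable v μ) (hM : ∀ᵐ x ∂μ, |v x| ≤ M) :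
    HasDerivAt (fun t : ℝ => ∫ x, φ x * Real.exp (t * v x) ∂μ) (∫ x, φ x * v x ∂μ) 0 := by
  have hφv : Integrable (fun x => φ x * v x) μ := hφ.mul_bdd hv hM
  have hderiv := hasDerivAt_integral_mul_exp (φ := fun x => (φ x : ℂ)) (u := fun x => (v x : ℂ))
    hφ.ofReal (Complex.continuous_ofReal.comp_aestronglyMeasurable hv)
    (by simpa using hφv.ofReal (𝕜 := ℂ)) (by simpa using hM)
  have hre := Complex.reCLM.hasFDerivAt.comp_hasDerivAt 0 hderiv
  simpa [Function.comp_def, ← Complex.ofReal_mul, ← Complex.ofReal_exp, integral_complex_ofReal]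
    using hre

theorem eLpNorm_two_le_iff_integral_norm_sq_le {α E : Type*} [MeasurableSpace α]
    [NormedAddCommGroup E] {μ : Measure α} {g h : α → E} (hg : MemLp g 2 μ) (hh : MemLp h 2 μ) :
    eLpNorm g 2 μ ≤ eLpNorm h 2 μ ↔ ∫ x, ‖g x‖ ^ 2 ∂μ ≤ ∫ x, ‖h x‖ ^ 2 ∂μ := by
  have hnonneg (k : α → E) : 0 ≤ ∫ x, ‖k x‖ ^ 2 ∂μ := integral_nonneg fun x => sq_nonneg _
  rw [hg.eLpNorm_eq_integral_rpow_norm two_ne_zero ENNReal.ofNat_ne_top,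
    hh.eLpNorm_eq_integral_rpow_norm two_ne_zero ENNReal.ofNat_ne_top]
  simp only [ENNReal.toReal_ofNat, Real.rpow_ofNat]
  rw [ENNReal.ofReal_le_ofReal_iff (Real.rpow_nonneg (hnonneg h) _),
    Real.rpow_le_rpow_iff (hnonneg g) (hnonneg h) (by positivity)]

theorem norm_sub_mul_exp_sq (a b z : ℂ) :
    ‖a - b * Complex.exp z‖ ^ 2 = ‖a‖ ^ 2 - 2 * (conj a * b * Complex.exp z).re +
      ‖b‖ ^ 2 * Real.exp (2 * z.re) := by
  have hexp : Real.exp (2 * z.re) = ‖Complex.exp z‖ ^ 2 := by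
    rw [Complex.norm_exp, ← Real.exp_nat_mul, Nat.cast_ofNat]
  rw [hexp, ← mul_pow, ← norm_mul, mul_assoc, norm_sub_sq (𝕜 := ℂ), RCLike.inner_apply',
    RCLike.re_eq_complex_re]

theorem integral_norm_sub_mul_exp_sq {α : Type*} [MeasurableSpace α] {μ : Measure α}
    {f g u : α → ℂ} (hf : MemLp f 2 μ)
    (hgu : MemLp (fun x => g x * Complex.exp (u x)) 2 μ) :
    ∫ x, ‖f x - g x * Complex.exp (u x)‖ ^ 2 ∂μ = ∫ x, ‖f x‖ ^ 2 ∂μ -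
      2 * (∫ x, conj (f x) * g x * Complex.exp (u x) ∂μ).re +
        ∫ x, ‖g x‖ ^ 2 * Real.exp (2 * (u x).re) ∂μ := by
  have hcross : Integrable (fun x => conj (f x) * g x * Complex.exp (u x)) μ :=
    (hf.star.integrable_mul hgu).congr (.of_forall fun x => (mul_assoc _ _ _).symm)
  have hcross_re : Integrable (fun x => 2 * (conj (f x) * g x * Complex.exp (u x)).re) μ :=
    hcross.re.const_mul 2
  have hfsq : Integrable (fun x => ‖f x‖ ^ 2) μ := hf.integrable_norm_pow two_ne_zero
  have hsq : Integrable (fun x => ‖g x‖ ^ 2 * Real.exp (2 * (u x).re)) μ := by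
    refine (hgu.integrable_norm_pow two_ne_zero).congr (.of_forall fun x => ?_)
    simp only [norm_mul, Complex.norm_exp, mul_pow, ← Real.exp_nat_mul, Nat.cast_ofNat]
  have hre : ∫ x, (conj (f x) * g x * Complex.exp (u x)).re ∂μ =
    (∫ x, conj (f x) * g x * Complex.exp (u x) ∂μ).re := integral_re hcross
  simp_rw [norm_sub_mul_exp_sq]
  rw [integral_add (by fun_prop) hsq, integral_sub hfsq hcross_re, integral_const_mul, hre]

section

variable {I : Set UCircle} {f g₀ u : UCircle → ℂ}

theorem IsCandidate.mul_exp (hg₀ : IsCandidate I g₀) (hu : IsBoundedReLimit u)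
    (hu0 : ∀ᵐ θ ∂ell.restrict Iᶜ, (u θ).re = 0) :
    IsCandidate I fun θ => g₀ θ * Complex.exp (u θ) := by
  refine ⟨hu.memHardy_mul_exp one_le_two hg₀.1, ?_⟩
  filter_upwards [hg₀.2, hu0] with θ hθ hθu
  rwa [norm_mul, Complex.norm_exp, hθu, Real.exp_zero, mul_one]

theorem IsBEPSolution.isLocalMin (hg₀ : IsBEPSolution I f g₀) (hf : MemLp f 2 (ell.restrict I))
    (hu : IsBoundedReLimit u) (hu0 : ∀ᵐ θ ∂ell.restrict Iᶜ, (u θ).re = 0) :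
    IsLocalMin (fun t : ℝ => ∫ θ in I, ‖f θ - g₀ θ * Complex.exp (t * u θ)‖ ^ 2 ∂ell) 0 := by
  have hcand (t : ℝ) : IsCandidate I fun θ => g₀ θ * Complex.exp (t * u θ) := by
    refine hg₀.1.mul_exp (hu.real_mul t) ?_
    filter_upwards [hu0] with θ hθ
    rw [Complex.re_ofReal_mul, hθ, mul_zero]
  refine .of_forall fun t => ?_
  have hle := (eLpNorm_two_le_iff_integral_norm_sq_le (hf.sub (hg₀.1.1.1.restrict I))
    (hf.sub ((hcand t).1.1.restrict I))).1 (hg₀.2 _ (hcand t))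
  simpa using hle

theorem IsBEPSolution.integral_norm_sq_mul_re (hg₀ : IsBEPSolution I f g₀)
    (hf : MemLp f 2 (ell.restrict I)) (hu : IsBoundedReLimit u)
    (hu0 : ∀ᵐ θ ∂ell.restrict Iᶜ, (u θ).re = 0)
    (hint : Integrable (fun θ => conj (f θ) * g₀ θ * u θ) (ell.restrict I)) :
    ∫ θ in I, ‖g₀ θ‖ ^ 2 * (u θ).re ∂ell = ∫ θ in I, (conj (f θ) * g₀ θ * u θ).re ∂ell := by
  obtain ⟨M, hM⟩ := hu.exists_abs_re_le
  have hg : MemLp g₀ 2 (ell.restrict I) := hg₀.1.1.1.restrict I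
  have hum := hu.aestronglyMeasurable.restrict (s := I)
  have hMI := ae_restrict_of_ae (s := I) hM
  have hcross : HasDerivAt
      (fun t : ℝ => ∫ θ in I, conj (f θ) * g₀ θ * Complex.exp (t * u θ) ∂ell)
      (∫ θ in I, conj (f θ) * g₀ θ * u θ ∂ell) 0 :=
    hasDerivAt_integral_mul_exp (hf.star.integrable_mul hg) hum hint hMI
  have hcross_re := Complex.reCLM.hasFDerivAt.comp_hasDerivAt 0 hcross
  have hsq := hasDerivAt_integral_mul_rexp (hg.integrable_norm_pow two_ne_zero)
    (hum.re.const_mul 2) (M := 2 * M) (by simpa [abs_mul] using hMI)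
  have hF := ((hcross_re.const_mul 2).const_sub (∫ θ in I, ‖f θ‖ ^ 2 ∂ell)).add hsq
  have hexpand (t : ℝ) := integral_norm_sub_mul_exp_sq hf
    ((hu.real_mul t).memHardy_mul_exp one_le_two hg₀.1.1 |>.1.restrict I)
  have hmin := hg₀.isLocalMin hf hu hu0
  simp_rw [hexpand, Complex.re_ofReal_mul, mul_left_comm (2 : ℝ)] at hmin
  have hzero := hmin.hasDerivAt_eq_zero hF
  have hre : ∫ θ in I, (conj (f θ) * g₀ θ * u θ).re ∂ell =
    (∫ θ in I, conj (f θ) * g₀ θ * u θ ∂ell).re := integral_re hint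
  rw [hre]
  simp only [Complex.reCLM_apply, RCLike.re_eq_complex_re, mul_left_comm _ (2 : ℝ),
    integral_const_mul] at hzero
  linarith

end

section

variable {I : Set UCircle} {f g₀ : UCircle → ℂ} {k : UCircle → ℝ} {s : ℝ≥0∞}

theorem IsConjugate.integral_mul_im_add_mul_re {r : ℝ≥0∞} [ENNReal.HolderConjugate s r]
    {v : UCircle → ℝ} (hvk : IsConjugate v k) (hv : MemLp v s ell) (hk : MemLp k s ell)
    {P : ℕ → ℂ[X]} {u : UCircle → ℂ} (hu : IsHardyApprox r P u) :
    ∫ θ, (v θ * (u θ).im + k θ * (u θ).re) ∂ell = 0 := by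
  have hs : 1 ≤ s := ENNReal.HolderConjugate.one_le s r
  have hr : 1 ≤ r := ENNReal.HolderConjugate.one_le r s
  have hmemLp : MemLp (fun θ => (v θ : ℂ) + Complex.I * k θ) s ell :=
    (hv.ofReal (K := ℂ)).add ((hk.ofReal (K := ℂ)).const_mul Complex.I)
  have hhardy : MemHardy s fun θ => (v θ : ℂ) + Complex.I * k θ :=
    ⟨hmemLp, fun n hn => hvk.fourierCoeff_add_I_mul_of_neg (hv.integrable hs) hn⟩
  have hmean_im : (∫ θ, ((v θ : ℂ) + Complex.I * k θ) ∂ell).im = 0 := by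
    rw [← RCLike.im_eq_complex_im, ← integral_im (hmemLp.integrable hs)]
    simpa using hvk.integral_eq_zero
  have hint : Integrable (fun θ => ((v θ : ℂ) + Complex.I * k θ) * u θ) ell :=
    hmemLp.integrable_mul hu.memLp
  calc ∫ θ, (v θ * (u θ).im + k θ * (u θ).re) ∂ell
      = ∫ θ, (((v θ : ℂ) + Complex.I * k θ) * u θ).im ∂ell := by simp
    _ = (∫ θ, ((v θ : ℂ) + Complex.I * k θ) * u θ ∂ell).im := integral_im hint
    _ = 0 := by
        rw [hu.integral_mul hhardy, Complex.mul_im, hmean_im, hu.im_integral_eq_zero hr]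
        simp

theorem IsBEPSolution.integral_norm_sq_mul (hI : MeasurableSet I) (hg₀ : IsBEPSolution I f g₀)
    (hf : MemLp f 2 (ell.restrict I)) (hs : 1 < s) (hs_top : s ≠ ∞)
    (hφ : MemLp (fun θ => conj (f θ) * g₀ θ) s (ell.restrict I))
    (hk : IsConjugate (I.indicator fun θ => (conj (f θ) * g₀ θ).im) k) (hks : MemLp k s ell)
    {w : UCircle → ℝ} (hw : MemLp w ∞ ell) (hwI : ∀ θ ∉ I, w θ = 0) :
    ∫ θ in I, ‖g₀ θ‖ ^ 2 * w θ ∂ell = ∫ θ in I, ((conj (f θ) * g₀ θ).re + k θ) * w θ ∂ell := by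
  have hconj := ENNReal.HolderConjugate.conjExponent hs.le
  set r := ENNReal.conjExponent s
  obtain ⟨P, l, hu, hu_bdd⟩ := exists_isHardyApprox_isBoundedReLimit
    ((ENNReal.HolderConjugate.lt_top_iff_one_lt s r).1 hs_top.lt_top)
    ((ENNReal.HolderConjugate.ne_top_iff_ne_one r s).2 hs.ne') hw
  have hφu := hφ.integrable_mul (hu.memLp.restrict I)
  have hfirst := hg₀.integral_norm_sq_mul_re hf hu_bdd
    (ae_restrict_of_forall_mem hI.compl fun θ hθ => by simp [hwI θ hθ]) hφu
  have hpair : ∫ θ in I, ((conj (f θ) * g₀ θ).im * l θ + k θ * w θ) ∂ell = 0 := by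
    rw [← integral_indicator hI,
      ← hk.integral_mul_im_add_mul_re ((memLp_indicator_iff_restrict hI).2 hφ.im) hks hu]
    refine integral_congr_ae (.of_forall fun θ => ?_)
    by_cases hθ : θ ∈ I <;> simp [hθ, hwI]
  have hwr : MemLp w r (ell.restrict I) := (hw.mono_exponent le_top).restrict I
  have hlr : MemLp l r (ell.restrict I) := by simpa using (hu.memLp.restrict I).im
  have hright : Integrable (fun θ => ((conj (f θ) * g₀ θ).re + k θ) * w θ) (ell.restrict I) :=
    (hφ.re.add (hks.restrict I)).integrable_mul hwr
  have hcross : Integrable (fun θ => (conj (f θ) * g₀ θ).im * l θ + k θ * w θ) (ell.restrict I) :=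
    (hφ.im.integrable_mul hlr).add ((hks.restrict I).integrable_mul hwr)
  calc ∫ θ in I, ‖g₀ θ‖ ^ 2 * w θ ∂ell
      = ∫ θ in I, (conj (f θ) * g₀ θ * (w θ + Complex.I * l θ)).re ∂ell := by
        simpa using hfirst
    _ = ∫ θ in I, (((conj (f θ) * g₀ θ).re + k θ) * w θ -
          ((conj (f θ) * g₀ θ).im * l θ + k θ * w θ)) ∂ell := by
        refine integral_congr_ae (.of_forall fun θ => ?_)
        beta_reduce
        have hre : ((w θ : ℂ) + Complex.I * l θ).re = w θ := by simp
        have him : ((w θ : ℂ) + Complex.I * l θ).im = l θ := by simp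
        rw [Complex.mul_re, hre, him]
        ring
    _ = ∫ θ in I, ((conj (f θ) * g₀ θ).re + k θ) * w θ ∂ell := by
        rw [integral_sub hright hcross, hpair, sub_zero]

theorem IsBEPSolution.norm_sq_eq (hI : MeasurableSet I) (hg₀ : IsBEPSolution I f g₀)
    (hf : MemLp f 2 (ell.restrict I)) (hs : 1 < s) (hs_top : s ≠ ∞)
    (hφ : MemLp (fun θ => conj (f θ) * g₀ θ) s (ell.restrict I))
    (hk : IsConjugate (I.indicator fun θ => (conj (f θ) * g₀ θ).im) k) (hks : MemLp k s ell) :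
    ∀ᵐ θ ∂ell.restrict I, ‖g₀ θ‖ ^ 2 = (conj (f θ) * g₀ θ).re + k θ := by
  have hg_sq : Integrable (fun θ => ‖g₀ θ‖ ^ 2) (ell.restrict I) :=
    (hg₀.1.1.1.restrict I).integrable_norm_pow two_ne_zero
  have hright : Integrable (fun θ => (conj (f θ) * g₀ θ).re + k θ) (ell.restrict I) :=
    (hφ.integrable hs.le).re.add hk.1.integrableOn
  refine hg_sq.ae_eq_of_forall_setIntegral_eq _ _ hright fun A hA _ => ?_
  have htest := hg₀.integral_norm_sq_mul hI hf hs hs_top hφ hk hks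
    (w := (A ∩ I).indicator 1) ((memLp_const 1).indicator (hA.inter hI))
    fun θ hθ => Set.indicator_of_notMem (fun h => hθ h.2) _
  have hset (ψ : UCircle → ℝ) : ∫ θ in I, ψ θ * (A ∩ I).indicator 1 θ ∂ell =
      ∫ θ in A, ψ θ ∂ell.restrict I := by
    rw [← integral_indicator hA]
    refine setIntegral_congr_fun hI fun θ hθ => ?_
    by_cases hθA : θ ∈ A <;> simp [hθ, hθA]
  simpa only [hset] using htest

end

/-! ### Integrability of the solution -/

theorem IsBEPSolution.eLpNorm_sq_le {I : Set UCircle} (hI : MeasurableSet I) {f g₀ : UCircle → ℂ}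
    (hg₀ : IsBEPSolution I f g₀) {p q s C : ℝ≥0∞} [ENNReal.HolderTriple p q s] (hp : 2 ≤ p)
    (hs : 1 < s) (hs_top : s ≠ ∞) (hf : MemLp f p (ell.restrict I))
    (hgq : MemLp g₀ q (ell.restrict I)) (hC : IsConjugationBound s C) (hC_top : C ≠ ∞) :
    eLpNorm g₀ (2 * s) (ell.restrict I) ^ 2 ≤
      (1 + C) * (eLpNorm f p (ell.restrict I) * eLpNorm g₀ q (ell.restrict I)) := by
  set φ : UCircle → ℂ := fun θ => conj (f θ) * g₀ θ
  have hφ : MemLp φ s (ell.restrict I) := hgq.mul hf.star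
  have hφ_le : eLpNorm φ s (ell.restrict I) ≤
      eLpNorm f p (ell.restrict I) * eLpNorm g₀ q (ell.restrict I) :=
    (eLpNorm_mul_le_mul_eLpNorm hf.1.star hgq.1).trans_eq (by rw [eLpNorm_star])
  have hv : MemLp (I.indicator fun θ => (φ θ).im) s ell := (memLp_indicator_iff_restrict hI).2 hφ.im
  obtain ⟨k, hk, hk_le⟩ := hC _ hv
  have hks : MemLp k s ell := ⟨hk.1.1, hk_le.trans_lt (ENNReal.mul_lt_top hC_top.lt_top hv.2)⟩
  have hv_le : eLpNorm (I.indicator fun θ => (φ θ).im) s ell ≤ eLpNorm φ s (ell.restrict I) := by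
    rw [eLpNorm_indicator_eq_eLpNorm_restrict hI]
    exact eLpNorm_mono fun θ => Complex.abs_im_le_norm _
  have hid := hg₀.norm_sq_eq hI (hf.mono_exponent hp) hs hs_top hφ hk hks
  calc eLpNorm g₀ (2 * s) (ell.restrict I) ^ 2
      = eLpNorm (fun θ => ‖g₀ θ‖ ^ 2) s (ell.restrict I) := (eLpNorm_norm_sq_eq g₀ s).symm
    _ = eLpNorm ((fun θ => (φ θ).re) + k) s (ell.restrict I) := eLpNorm_congr_ae hid
    _ ≤ eLpNorm (fun θ => (φ θ).re) s (ell.restrict I) + eLpNorm k s (ell.restrict I) :=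
        eLpNorm_add_le hφ.re.1 hk.1.1.restrict hs.le
    _ ≤ eLpNorm φ s (ell.restrict I) + C * eLpNorm φ s (ell.restrict I) := by
        gcongr ?_ + ?_
        · exact eLpNorm_mono fun θ => Complex.abs_re_le_norm _
        · calc eLpNorm k s (ell.restrict I) ≤ eLpNorm k s ell :=
                eLpNorm_mono_measure k Measure.restrict_le_self
            _ ≤ C * eLpNorm φ s (ell.restrict I) := hk_le.trans (by gcongr)
    _ = (1 + C) * eLpNorm φ s (ell.restrict I) := by ring
    _ ≤ _ := by gcongr

theorem tendsto_coe_rpow {ι : Type*} {l : Filter ι} {y : ι → ℝ} {b : ℝ} (hb : 0 < b)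
    (hy : Tendsto y l (𝓝 b)) (c : NNReal) :
    Tendsto (fun i => (c : ℝ≥0∞) ^ y i) l (𝓝 ((c : ℝ≥0∞) ^ b)) := by
  rw [← ENNReal.coe_rpow_of_nonneg _ hb.le]
  refine (ENNReal.tendsto_coe.2 (tendsto_const_nhds.nnrpow hy (.inr hb))).congr' ?_
  filter_upwards [hy.eventually_const_lt hb] with i hi
  exact ENNReal.coe_rpow_of_nonneg c hi.le

theorem eLpNorm_le_of_tendsto_exponent {α E : Type*} [MeasurableSpace α] [NormedAddCommGroup E]
    {μ : Measure α} {g : α → E} (hg : AEStronglyMeasurable g μ) {q : ℕ → ℝ≥0∞} {p : ℝ≥0∞}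
    (hp : p ≠ 0) (hp_top : p ≠ ∞) (hq : ∀ n, q n ≠ 0) (hq_top : ∀ n, q n ≠ ∞)
    (hqp : Tendsto q atTop (𝓝 p)) {M : NNReal} (hM : ∀ n, eLpNorm g (q n) μ ≤ M) :
    eLpNorm g p μ ≤ M := by
  have hiff {r : ℝ≥0∞} (hr : r ≠ 0) (hr_top : r ≠ ∞) : eLpNorm g r μ ≤ M ↔
      ∫⁻ x, ‖g x‖ₑ ^ r.toReal ∂μ ≤ (M : ℝ≥0∞) ^ r.toReal := by
    rw [eLpNorm_eq_lintegral_rpow_enorm_toReal hr hr_top, one_div,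
      ENNReal.rpow_inv_le_iff (ENNReal.toReal_pos hr hr_top)]
  have hlim (c : NNReal) : Tendsto (fun n => (c : ℝ≥0∞) ^ (q n).toReal) atTop
      (𝓝 ((c : ℝ≥0∞) ^ p.toReal)) :=
    tendsto_coe_rpow (ENNReal.toReal_pos hp hp_top) ((ENNReal.tendsto_toReal hp_top).comp hqp) c
  rw [hiff hp hp_top]
  calc ∫⁻ x, ‖g x‖ₑ ^ p.toReal ∂μ
      = ∫⁻ x, liminf (fun n => ‖g x‖ₑ ^ (q n).toReal) atTop ∂μ :=
        lintegral_congr fun x => (hlim ‖g x‖₊).liminf_eq.symm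
    _ ≤ liminf (fun n => ∫⁻ x, ‖g x‖ₑ ^ (q n).toReal ∂μ) atTop :=
        lintegral_liminf_le' fun n => hg.enorm.pow_const _
    _ ≤ liminf (fun n => (M : ℝ≥0∞) ^ (q n).toReal) atTop :=
        liminf_le_liminf (.of_forall fun n => (hiff (hq n) (hq_top n)).1 (hM n))
    _ = (M : ℝ≥0∞) ^ p.toReal := (hlim M).liminf_eq

theorem exists_seq_holderTriple {p q₀ : ℝ≥0∞} (hq₀ : q₀ ≠ 0) (hq₀p : q₀ ≤ p) :
    ∃ q : ℕ → ℝ≥0∞, q 0 = q₀ ∧ (∀ n, q n ∈ Set.Icc q₀ p) ∧ Tendsto q atTop (𝓝 p) ∧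
      ∀ n, ENNReal.HolderTriple p (q n) (q (n + 1) / 2) := by
  obtain ⟨d, hd⟩ := exists_add_of_le (ENNReal.inv_le_inv.2 hq₀p)
  have hd_top : d ≠ ∞ := fun h => hq₀ (by simpa [h] using hd)
  refine ⟨fun n => (p⁻¹ + d * 2⁻¹ ^ n)⁻¹, by simp [← hd], fun n => ⟨?_, ?_⟩, ?_, fun n => ⟨?_⟩⟩
  · rw [ENNReal.le_inv_iff_le_inv, hd]
    gcongr
    exact mul_le_of_le_one_right' (pow_le_one₀ zero_le (by simp))
  · exact ENNReal.inv_le_iff_inv_le.2 le_self_add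
  · have hpow : Tendsto (fun n : ℕ => (2⁻¹ : ℝ≥0∞) ^ n) atTop (𝓝 0) :=
      ENNReal.tendsto_pow_atTop_nhds_zero_of_lt_one (by simp)
    simpa using ((ENNReal.Tendsto.const_mul hpow (.inr hd_top)).const_add p⁻¹).inv
  · have htwo : (2 : ℝ≥0∞) * 2⁻¹ = 1 := ENNReal.mul_inv_cancel two_ne_zero ENNReal.ofNat_ne_top
    rw [div_eq_mul_inv, ENNReal.mul_inv (.inr (by simp)) (.inr (by simp))]
    simp only [inv_inv]
    calc p⁻¹ + (p⁻¹ + d * 2⁻¹ ^ n) = 2 * p⁻¹ + 2 * 2⁻¹ * (d * 2⁻¹ ^ n) := by rw [htwo]; ring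
      _ = (p⁻¹ + d * 2⁻¹ ^ (n + 1)) * 2 := by ring

theorem memLp_of_eLpNorm_sq_le {α E : Type*} [MeasurableSpace α] [NormedAddCommGroup E]
    {μ : Measure α} {g : α → E} {p q₀ B : ℝ≥0∞} (hp_top : p ≠ ∞) (hq₀ : q₀ ≠ 0) (hq₀p : q₀ ≤ p)
    (hg : MemLp g q₀ μ) (hB : B ≠ ∞)
    (h : ∀ q s, q ∈ Set.Icc q₀ p → ENNReal.HolderTriple p q s → MemLp g q μ →
      eLpNorm g (2 * s) μ ^ 2 ≤ B * eLpNorm g q μ) :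
    MemLp g p μ := by
  obtain ⟨q, hq0, hq_mem, hqp, hq_triple⟩ := exists_seq_holderTriple hq₀ hq₀p
  obtain ⟨M, hM⟩ : ∃ M : NNReal, (M : ℝ≥0∞) = max (eLpNorm g q₀ μ) B :=
    ⟨_, ENNReal.coe_toNNReal (max_lt hg.2 hB.lt_top).ne⟩
  have hbound (n : ℕ) : eLpNorm g (q n) μ ≤ M := by
    induction n with
    | zero => rw [hq0, hM]; exact le_max_left _ _
    | succ n ih =>
      have hstep := h (q n) _ (hq_mem n) (hq_triple n) ⟨hg.1, ih.trans_lt ENNReal.coe_lt_top⟩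
      rw [ENNReal.mul_div_cancel two_ne_zero ENNReal.ofNat_ne_top] at hstep
      refine (ENNReal.pow_le_pow_left_iff two_ne_zero).1 (hstep.trans ?_)
      rw [sq]
      exact mul_le_mul' (hM ▸ le_max_right _ _) ih
  have hq_ne_zero (n : ℕ) : q n ≠ 0 := (hq₀.bot_lt.trans_le (hq_mem n).1).ne'
  have hq_ne_top (n : ℕ) : q n ≠ ∞ := ((hq_mem n).2.trans_lt hp_top.lt_top).ne
  exact ⟨hg.1, (eLpNorm_le_of_tendsto_exponent hg.1 (hq₀.bot_lt.trans_le hq₀p).ne' hp_top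
    hq_ne_zero hq_ne_top hqp hbound).trans_lt ENNReal.coe_lt_top⟩

theorem IsBEPSolution.memLp_restrict {I : Set UCircle} (hI : MeasurableSet I)
    {f g₀ : UCircle → ℂ} (hg₀ : IsBEPSolution I f g₀) {p : ℝ≥0∞} (hp : 2 < p) (hp_top : p ≠ ∞)
    (hf : MemLp f p (ell.restrict I)) : MemLp g₀ p (ell.restrict I) := by
  have ha : 1 < (p⁻¹ + 2⁻¹)⁻¹ := by
    rw [ENNReal.one_lt_inv, ← ENNReal.inv_two_add_inv_two]
    exact ENNReal.add_lt_add_right (by simp) (ENNReal.inv_lt_inv.2 hp)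
  obtain ⟨K, hK⟩ := exists_rieszBound_Icc ha hp_top
  refine memLp_of_eLpNorm_sq_le hp_top two_ne_zero hp.le (hg₀.1.1.1.restrict I)
    (B := (1 + K) * eLpNorm f p (ell.restrict I)) (by finiteness [hf.2.ne]) ?_
  intro q s hq hpqs hgq
  have hs_inv : s⁻¹ = p⁻¹ + q⁻¹ := (ENNReal.HolderTriple.inv_add_inv_eq_inv p q s).symm
  have hs_mem : s ∈ Set.Icc (p⁻¹ + 2⁻¹)⁻¹ p := by
    constructor
    · rw [ENNReal.inv_le_iff_inv_le, hs_inv]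
      gcongr
      exact hq.1
    · rw [← ENNReal.inv_le_inv, hs_inv]
      exact le_self_add
  have hs : 1 < s := ha.trans_le hs_mem.1
  have hs_top : s ≠ ∞ := (hs_mem.2.trans_lt hp_top.lt_top).ne
  rw [mul_assoc]
  exact hg₀.eLpNorm_sq_le hI hp.le hs hs_top hf hgq
    ((hK s hs_mem).isConjugationBound hs.le hs_top) ENNReal.coe_ne_top

theorem IsCandidate.memHardy {I : Set UCircle} (hI : MeasurableSet I) {g : UCircle → ℂ}
    (hg : IsCandidate I g) {p : ℝ≥0∞} (hgI : MemLp g p (ell.restrict I)) : MemHardy p g := by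
  have hgJ : MemLp g p (ell.restrict Iᶜ) := MemLp.of_bound hg.1.1.1.restrict 1 hg.2
  refine ⟨?_, hg.1.2⟩
  rw [← Set.indicator_self_add_compl I g]
  exact ((memLp_indicator_iff_restrict hI).2 hgI).add
    ((memLp_indicator_iff_restrict hI.compl).2 hgJ)

theorem one_lt_div_two {p : ℝ≥0∞} (hp : 2 < p) : 1 < p / 2 := by
  rwa [ENNReal.lt_div_iff_mul_lt (by simp) (by simp), one_mul]

theorem IsBEPSolution.eLpNorm_le {I : Set UCircle} (hI : MeasurableSet I) {f g₀ : UCircle → ℂ}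
    (hg₀ : IsBEPSolution I f g₀) {p C : ℝ≥0∞} (hp : 2 < p) (hp_top : p ≠ ∞)
    (hf : MemLp f p (ell.restrict I)) (hC : IsConjugationBound (p / 2) C) (hC_top : C ≠ ∞) :
    eLpNorm g₀ p (ell.restrict I) ≤ (1 + C) * eLpNorm f p (ell.restrict I) := by
  have hgp := hg₀.memLp_restrict hI hp hp_top hf
  have htwo : 2 * (p / 2) = p := ENNReal.mul_div_cancel two_ne_zero ENNReal.ofNat_ne_top
  have : ENNReal.HolderTriple p p (p / 2) := by simpa only [htwo] using holderTriple_two_mul (p / 2)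
  have hsq := hg₀.eLpNorm_sq_le hI hp.le (one_lt_div_two hp)
    (ENNReal.div_ne_top hp_top two_ne_zero) hf hgp hC hC_top
  rw [htwo, sq, ← mul_assoc] at hsq
  rcases eq_or_ne (eLpNorm g₀ p (ell.restrict I)) 0 with hzero | hzero
  · rw [hzero]
    exact zero_le
  · exact (ENNReal.mul_le_mul_iff_left hzero hgp.2.ne).1 hsq

theorem IsBEPSolution.congr_set {I I' : Set UCircle} {f g₀ : UCircle → ℂ}
    (hg₀ : IsBEPSolution I f g₀) (h : I =ᵐ[ell] I') : IsBEPSolution I' f g₀ := by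
  simpa only [IsBEPSolution, IsCandidate, Measure.restrict_congr_set h,
    Measure.restrict_congr_set h.compl] using hg₀

theorem mainTheorem7_general {I : Set UCircle} (hI : NullMeasurableSet I ell) {p : ℝ≥0∞}
    (hp : 2 < p) (hp_top : p ≠ ∞) {f : UCircle → ℂ} (hf : MemLp f p (ell.restrict I))
    {g₀ : UCircle → ℂ} (hg₀ : IsBEPSolution I f g₀) :
    MemHardy p g₀ ∧ conjugationNorm (p / 2) ≠ ∞ ∧
      eLpNorm g₀ p (ell.restrict I) ≤
        (1 + conjugationNorm (p / 2)) * eLpNorm f p (ell.restrict I) := by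
  obtain ⟨I', -, hI', hI'I⟩ := hI.exists_measurable_superset_ae_eq
  rw [← Measure.restrict_congr_set hI'I] at hf ⊢
  replace hg₀ := hg₀.congr_set hI'I.symm
  have hnorm : conjugationNorm (p / 2) ≠ ∞ :=
    conjugationNorm_ne_top (one_lt_div_two hp) (ENNReal.div_ne_top hp_top two_ne_zero)
  have hbounds : {C | IsConjugationBound (p / 2) C}.Nonempty :=
    Set.nonempty_iff_ne_empty.2 fun h => hnorm ((congrArg sInf h).trans sInf_empty)
  refine ⟨hg₀.1.memHardy hI' (hg₀.memLp_restrict hI' hp hp_top hf), hnorm, ?_⟩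
  obtain ⟨C, -, hC, hC_mem⟩ := exists_seq_tendsto_sInf hbounds (OrderBot.bddBelow _)
  refine ge_of_tendsto (ENNReal.Tendsto.mul_const (hC.const_add 1) (.inr hf.2.ne)) ?_
  filter_upwards [hC.eventually_lt_const hnorm.lt_top] with n hn
  exact hg₀.eLpNorm_le hI' hp hp_top hf (hC_mem n) hn.ne

end

theorem mainTheorem7 (I : Set UCircle) (hI : 0 < ell I) (hJ : 0 < ell Iᶜ)
    (hbd : ell (frontier I) = 0) (p : ℝ≥0∞) (hp : 2 < p) (hp_top : p ≠ ∞)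
    (f : UCircle → ℂ) (hf : MemLp f p (ell.restrict I))
    (g₀ : UCircle → ℂ) (hg₀ : IsBEPSolution I f g₀) :
    MemHardy p g₀ ∧
      conjugationNorm (p / 2) ≠ ∞ ∧
      eLpNorm g₀ p (ell.restrict I) ≤
        (1 + conjugationNorm (p / 2)) * eLpNorm f p (ell.restrict I) :=
  mainTheorem7_general (isOpen_interior.measurableSet.nullMeasurableSet.congr
    (interior_ae_eq_of_null_frontier hbd)) hp hp_top hf hg₀
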